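/- Let $K$ be a field of characteristic zero, let $A_n$ be the $n$-th Weyl algebra over $K$ (generators $q_1,\dots,q_n,p_1,\dots,p_n$, relations $[p_i,q_j]=\delta_{ij}$, $[p_i,p_j]=[q_i,q_j]=0$), let $P_m=K[x_{2n+1},\dots,x_{2n+m}]$ be a polynomial algebra, and put $A:=A_n\otimes_K P_m$, $s:=2n+m$, $x_i:=q_i$, $x_{n+i}:=p_i$ for $1\le i\le n$. Write $\partial/\partial x_{2n+l}$ for the derivation $\mathrm{id}\otimes\partial/\partial x_{2n+l}$ of $A$, $[a,b]:=ab-ba$, and $N(f,A):=\{a\in A : f^k(a)=0\text{ for some }k\ge 0\}$ for a map $f:A\to A$. Let $\sigma$ be a $K$-algebra endomorphism of $A$ such that $\Delta:=\det\left(\partial\sigma(x_{2n+i})/\partial x_{2n+j}\right)_{1\le i,j\le m}\in K^*$. Put $x'_i:=\sigma(x_i)$ for $1\le i\le s$ and define maps $\partial'_1,\dots,\partial'_s:A\to A$ by $$\partial'_i(a):=[x'_{n+i},a],\qquad \partial'_{n+i}(a):=-[x'_i,a]\qquad(1\le i\le n),$$ and, for $1\le j\le m$, let $\partial'_{2n+j}(a)$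 be $\Delta^{-1}$ times the determinant of the matrix obtained from $\left(\partial x'_{2n+k}/\partial x_{2n+l}\right)_{k,l}$ by replacing its $j$-th row by $(\partial a/\partial x_{2n+1},\dots,\partial a/\partial x_{2n+m})$. (Determinants are given by the Leibniz formula, the factors of each summand being taken in the order of the rows.) Let $B$ be the subalgebra of $A$ generated by $\sigma(A)$ and $P_m$. Then the following hold. 1. $\bigcap_{i=1}^s\{a\in A:\partial'_i(a)=0\}=K$. Moreover, $\bigcap_{i=1}^s N(\partial'_i,A)=\sigma(A)$ if and only if $x'_i\in N(\partial'_{2n+j},A)$ for all $1\le i\le 2n$ and $1\le j\le m$ (in particular, this equality holds whenever $\partial'_{2n+j}(x'_i)=0$ for all such $i,j$). 2. $\bigcap_{i=1}^{2n}N(\partial'_i,A)=B$, and there are $K$-derivations $\delta_1,\dots,\delta_m$ of $B$ with $\delta_j(x'_i)=1$ if $i=2n+j$ and $\delta_j(x'_i)=0$ otherwise $(1\le i\le s)$. 3. Let $D$ be any subalgebra with $B\subseteq D\subseteq A$ (for instance $D=B$ or $D=A$), and let $\delta_1,\dots,\delta_m$ be any $K$-derivations of $D$ with $\delta_j(x'_i)=1$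 if $i=2n+j$ and $\delta_j(x'_i)=0$ otherwise $(1\le i\le s)$. Then $\delta_j$ coincides with $\partial'_{2n+j}$ on $P_m$ for each $j$, and $$\Bigl\{a\in D : a\in N(\partial'_i,A)\ (1\le i\le 2n),\ a\in N(\delta_j,D)\ (1\le j\le m)\Bigr\}=\sigma(A),$$ $$\Bigl\{a\in D : \partial'_i(a)=0\ (1\le i\le 2n),\ \delta_j(a)=0\ (1\le j\le m)\Bigr\}=K.$$ -/

import Mathlib

open scoped TensorProduct

noncomputable section

namespace WeylPoly

/-- The defining relations of the `n`-th Weyl algebra in the free algebra on the letters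
`q_i = Sum.inl i` and `p_i = Sum.inr i`:
`[p_i, q_j] = δ_ij`, `[p_i, p_j] = 0`, `[q_i, q_j] = 0`. -/
inductive WeylRel (K : Type*) [Field K] (n : ℕ) :
    FreeAlgebra K (Fin n ⊕ Fin n) → FreeAlgebra K (Fin n ⊕ Fin n) → Prop
  | pq (i j : Fin n) : WeylRel K n
      (FreeAlgebra.ι K (Sum.inr i) * FreeAlgebra.ι K (Sum.inl j))
      (FreeAlgebra.ι K (Sum.inl j) * FreeAlgebra.ι K (Sum.inr i) + if i = j then 1 else 0)
  | pp (i j : Fin n) : WeylRel K n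
      (FreeAlgebra.ι K (Sum.inr i) * FreeAlgebra.ι K (Sum.inr j))
      (FreeAlgebra.ι K (Sum.inr j) * FreeAlgebra.ι K (Sum.inr i))
  | qq (i j : Fin n) : WeylRel K n
      (FreeAlgebra.ι K (Sum.inl i) * FreeAlgebra.ι K (Sum.inl j))
      (FreeAlgebra.ι K (Sum.inl j) * FreeAlgebra.ι K (Sum.inl i))

/-- The `n`-th Weyl algebra `A_n` over `K`. -/
abbrev Weyl (K : Type*) [Field K] (n : ℕ) : Type _ := RingQuot (WeylRel K n)

/-- The algebra `A_n ⊗ P_m`. -/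
abbrev Alg (K : Type*) [Field K] (n m : ℕ) : Type _ := Weyl K n ⊗[K] MvPolynomial (Fin m) K

/-- Labels of the canonical generators `x_1, …, x_s`, `s = 2n + m`:
`Sum.inl (Sum.inl i)` is `x_i = q_i`, `Sum.inl (Sum.inr i)` is `x_{n+i} = p_i` and
`Sum.inr j` is the central variable `x_{2n+j}`. -/
abbrev Gen (n m : ℕ) : Type := (Fin n ⊕ Fin n) ⊕ Fin m

variable {K : Type*} [Field K] {n m : ℕ}

/-- The canonical generators of `A_n ⊗ P_m`. -/
def gen : Gen n m → Alg K n m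
  | Sum.inl a => RingQuot.mkAlgHom K (WeylRel K n) (FreeAlgebra.ι K a) ⊗ₜ[K] 1
  | Sum.inr j => 1 ⊗ₜ[K] MvPolynomial.X j

/-- The partial derivative `∂ / ∂ x_{2n+l}` of `A_n ⊗ P_m`, that is `id ⊗ ∂ / ∂ x_{2n+l}`. -/
def centralPartial (l : Fin m) : Alg K n m →ₗ[K] Alg K n m :=
  LinearMap.lTensor (Weyl K n) (MvPolynomial.pderiv (R := K) l).toLinearMap

/-- The subalgebra `P_m = 1 ⊗ P_m` of `A_n ⊗ P_m`. -/
def polyPart (K : Type*) [Field K] (n m : ℕ) : Subalgebra K (Alg K n m) :=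
  (Algebra.TensorProduct.includeRight :
    MvPolynomial (Fin m) K →ₐ[K] Alg K n m).range

/-- The determinant by the Leibniz formula, for entries in a ring that is not assumed to be
commutative; in each summand the factors are multiplied in the order of the rows. When the entries
commute this is the usual determinant. -/
def leibnizDet {R : Type*} [Ring R] (M : Matrix (Fin m) (Fin m) R) : R :=
  ∑ π : Equiv.Perm (Fin m), (Equiv.Perm.sign π : ℤ) • (List.ofFn fun i => M i (π i)).prod

/-- The Jacobian matrix `(∂ σ(x_{2n+i}) / ∂ x_{2n+j})` of `σ` on the central variables. -/
def jac (σ : Alg K n m →ₐ[K] Alg K n m) : Matrix (Fin m) (Fin m) (Alg K n m) :=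
  Matrix.of fun i j => centralPartial j (σ (gen (Sum.inr i)))

/-- The maps `∂'_1, …, ∂'_s` attached to `σ`; here `Δ` is the Jacobian determinant of `σ`.
`∂'_i = ad σ(x_{n+i})` and `∂'_{n+i} = - ad σ(x_i)` for `i = 1, …, n`, and `∂'_{2n+j}(a)` is
`Δ⁻¹` times the determinant of the Jacobian matrix with its `j`-th row replaced by
`(∂a / ∂x_{2n+1}, …, ∂a / ∂x_{2n+m})`. -/
def partial' (σ : Alg K n m →ₐ[K] Alg K n m) (Δ : K) : Gen n m → Alg K n m → Alg K n m
  | Sum.inl (Sum.inl i), a =>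
      σ (gen (Sum.inl (Sum.inr i))) * a - a * σ (gen (Sum.inl (Sum.inr i)))
  | Sum.inl (Sum.inr i), a =>
      -(σ (gen (Sum.inl (Sum.inl i))) * a - a * σ (gen (Sum.inl (Sum.inl i))))
  | Sum.inr j, a => Δ⁻¹ • leibnizDet ((jac σ).updateRow j fun l => centralPartial l a)

/-- `N(f, X) = {a ∈ X | f^k(a) = 0 for some k}`. -/
def nilPart {X : Type*} [Zero X] (f : X → X) : Set X := {a | ∃ k : ℕ, f^[k] a = 0}

/-- The subalgebra of `A_n ⊗ P_m` generated by `σ(A_n ⊗ P_m)` and `P_m`. -/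
def imagePoly (σ : Alg K n m →ₐ[K] Alg K n m) : Subalgebra K (Alg K n m) :=
  σ.range ⊔ polyPart K n m

/-- `δ_1, …, δ_m` are `K`-derivations of the subalgebra `D` and, with `x'_g = σ(x_g)`, each `δ_j`
sends `x'_{2n+j}` to `1` and all the other `x'_g` to `0`. -/
def IsCentralPartials (σ : Alg K n m →ₐ[K] Alg K n m) (D : Subalgebra K (Alg K n m))
    (δ : Fin m → D →ₗ[K] D) : Prop :=
  (∀ j, ∀ a b : D, δ j (a * b) = δ j a * b + a * δ j b) ∧
  ∀ j, ∀ g : Gen n m, ∀ h : σ (gen g) ∈ D,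
    δ j ⟨σ (gen g), h⟩ = if g = Sum.inr j then 1 else 0

end WeylPoly

end

/-!
The elements `σ(q_i), σ(p_i)` satisfy the Weyl relations. A Gelfand–Kirillov dimension count shows
that their common centraliser in `A` is `P_m`: an element outside `P_m` would join them and the
coordinates of `P_m` to form one more element than `A` has coordinates, in triangular position with
respect to commuting derivations. Hence `σ` maps `P_m` into itself, the matrix with determinant `Δ`
is the Jacobian matrix of polynomials `f_j = σ(x_{2n+j})`, and `∂'_{2n+j}` is `id ⊗ ∂/∂f_j`.

When commuting derivations `D_i` and elements `x_j` satisfy `D_i x_j = δ_ij`, subtracting Taylor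
terms reduces an element on which all `D_i` are nilpotent to one killed by all of them, so the
nilpotent part is generated by the `x_j` and the common kernel. For `∂'_1, …, ∂'_{2n}` that kernel
is `P_m`; with the derivations dual to the `f_j` it shrinks to `K`.

The `δ_j` on `B` come from the injective endomorphism of `A` that agrees with `σ` on `A_n` and fixes
`P_m`: its image is `B`, and it transports `id ⊗ ∂/∂f_j` to `δ_j`.
-/

noncomputable section

namespace WeylPoly

section Nilpotency

variable {K M : Type*} [Field K] [AddCommGroup M] [Module K M]

theorem mem_nilPart_iff {D : Module.End K M} {a : M} :
    a ∈ nilPart D ↔ ∃ k : ℕ, (D ^ k) a = 0 := by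
  simp only [nilPart, Set.mem_ofPred_eq, Module.End.pow_apply]

theorem mem_nilPart_iff_mem_maxGenEigenspace {D : Module.End K M} {a : M} :
    a ∈ nilPart D ↔ a ∈ D.maxGenEigenspace 0 := by
  simp only [mem_nilPart_iff, Module.End.mem_maxGenEigenspace, zero_smul, sub_zero]

theorem mapsTo_nilPart {X Y : Type*} [Zero X] [Zero Y] {f : X → X} {g : Y → Y} {φ : X → Y}
    (hφ : φ 0 = 0) (h : Function.Semiconj φ f g) {a : X} (ha : a ∈ nilPart f) :
    φ a ∈ nilPart g := by
  obtain ⟨k, hk⟩ := ha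
  exact ⟨k, by rw [← (h.iterate_right k).eq, hk, hφ]⟩

/-- The nilpotency degree of `D` at `a` is `d`, the order of its last nonvanishing derivative. -/
def HasNilDegree (D : Module.End K M) (a : M) (d : ℕ) : Prop :=
  (D ^ d) a ≠ 0 ∧ (D ^ (d + 1)) a = 0

theorem exists_hasNilDegree {D : Module.End K M} {a : M} (ha : a ≠ 0) (h : a ∈ nilPart D) :
    ∃ d, HasNilDegree D a d := by
  classical
  rw [mem_nilPart_iff] at h
  obtain ⟨d, hd⟩ := Nat.exists_eq_succ_of_ne_zero
    (show Nat.find h ≠ 0 from fun h0 => ha (by simpa [h0] using Nat.find_spec h))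
  exact ⟨d, Nat.find_min h (by lia), by simpa [hd] using Nat.find_spec h⟩

theorem exists_ne_zero_forall_apply_eq_zero {ι : Type*} [Finite ι] {D : ι → Module.End K M}
    (hcomm : Pairwise fun i j => Commute (D i) (D j)) (hnil : ∀ i a, a ∈ nilPart (D i))
    {Q : Set M} (hQ : ∀ i, ∀ a ∈ Q, ∀ d, HasNilDegree (D i) a d → (D i ^ d) a ∈ Q)
    {a : M} (ha : a ∈ Q) (ha0 : a ≠ 0) : ∃ b ∈ Q, b ≠ 0 ∧ ∀ i, D i b = 0 := by
  classical
  have := Fintype.ofFinite ι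
  suffices h : ∀ s : Finset ι, ∃ b ∈ Q, b ≠ 0 ∧ ∀ i ∈ s, D i b = 0 by
    simpa using h Finset.univ
  intro s
  induction s using Finset.induction_on with
  | empty => exact ⟨a, ha, ha0, by simp⟩
  | insert i s his ih =>
    obtain ⟨b, hbQ, hb0, hb⟩ := ih
    obtain ⟨d, hd⟩ := exists_hasNilDegree hb0 (hnil i b)
    refine ⟨(D i ^ d) b, hQ i b hbQ d hd, hd.1, Finset.forall_mem_insert .. |>.2 ⟨?_, ?_⟩⟩
    · rw [← Module.End.mul_apply, ← pow_succ', hd.2]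
    · intro j hj
      have hji : j ≠ i := ne_of_mem_of_not_mem hj his
      rw [← Module.End.mul_apply, ((hcomm hji).pow_right d).eq, Module.End.mul_apply, hb j hj,
        map_zero]

end Nilpotency

section Taylor

variable {K M : Type*} [Field K] [AddCommGroup M] [Module K M] {D X : Module.End K M}

theorem lie_pow_succ_of_lie_eq_one (h : ⁅D, X⁆ = 1) (k : ℕ) :
    ⁅D, X ^ (k + 1)⁆ = (k + 1) • X ^ k := by
  induction k with
  | zero => simp [h]
  | succ k ih =>
    calc ⁅D, X ^ (k + 1 + 1)⁆ = ⁅D, X ^ (k + 1)⁆ * X + X ^ (k + 1) * ⁅D, X⁆ := by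
          simp only [pow_succ, Ring.lie_def]; noncomm_ring
      _ = (k + 1 + 1) • X ^ (k + 1) := by
          rw [ih, h, smul_mul_assoc, ← pow_succ, mul_one, ← succ_nsmul]

theorem pow_apply_pow_apply_of_lie_eq_one (h : ⁅D, X⁆ = 1) {b : M} (hb : D b = 0) (k : ℕ) :
    (D ^ k) ((X ^ k) b) = k.factorial • b := by
  induction k with
  | zero => simp
  | succ k ih =>
    have hDX : D ((X ^ (k + 1)) b) = (k + 1) • (X ^ k) b := by
      have := congr($(lie_pow_succ_of_lie_eq_one h k) b)
      rwa [Ring.lie_def, LinearMap.sub_apply, Module.End.mul_apply, Module.End.mul_apply, hb,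
        map_zero, sub_zero, LinearMap.smul_apply] at this
    rw [pow_succ, Module.End.mul_apply, hDX, map_nsmul, ih, smul_smul, Nat.factorial_succ]

theorem mem_invtSubmodule_pow {T : Submodule K M} (h : T ∈ D.invtSubmodule) (k : ℕ) :
    T ∈ (D ^ k).invtSubmodule := by
  rw [Module.End.mem_invtSubmodule_iff_mapsTo, Module.End.coe_pow]
  exact Set.MapsTo.iterate h k

theorem ker_mem_invtSubmodule_of_commute {f g : Module.End K M} (h : Commute f g) :
    LinearMap.ker f ∈ g.invtSubmodule := fun a (ha : f a = 0) => by
  rw [Submodule.mem_comap, LinearMap.mem_ker, ← Module.End.mul_apply, h.eq,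
    Module.End.mul_apply, ha, map_zero]

theorem iInf_maxGenEigenspace_mem_invtSubmodule_of_commute {ι : Type*} {D : ι → Module.End K M}
    {f : Module.End K M} {s : Finset ι} (h : ∀ j ∈ s, Commute (D j) f) (c : K) :
    ⨅ j ∈ s, (D j).maxGenEigenspace c ∈ f.invtSubmodule := by
  simp only [Module.End.mem_invtSubmodule_iff_forall_mem_of_mem, Submodule.mem_iInf]
  exact fun b hb j hj => Module.End.mapsTo_maxGenEigenspace_of_comm (h j hj) c (hb j hj)

variable [CharZero K]

/- With `D ^ (k + 1) a = 0`, subtracting the top Taylor term `X ^ k (D ^ k a) / k!` from `a` lowers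
the nilpotency degree. -/
theorem inf_maxGenEigenspace_le_of_lie_eq_one (h : ⁅D, X⁆ = 1) {T S : Submodule K M}
    (hTD : T ∈ D.invtSubmodule) (hTX : T ∈ X.invtSubmodule) (hSX : S ∈ X.invtSubmodule)
    (hker : T ⊓ LinearMap.ker D ≤ S) : T ⊓ D.maxGenEigenspace 0 ≤ S := by
  rintro a ⟨haT, ha⟩
  obtain ⟨k, hk⟩ := mem_nilPart_iff.1 (mem_nilPart_iff_mem_maxGenEigenspace.2 ha)
  clear ha
  induction k generalizing a with
  | zero => rw [show a = 0 by simpa using hk]; exact S.zero_mem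
  | succ k ih =>
    set b := (D ^ k) a with hb
    have hbD : D b = 0 := by rwa [hb, ← Module.End.mul_apply, ← pow_succ']
    have hbT : b ∈ T := mem_invtSubmodule_pow hTD k haT
    have hbS : b ∈ S := hker ⟨hbT, hbD⟩
    set c := (k.factorial : K)⁻¹ • (X ^ k) b with hc
    have hcT : c ∈ T := T.smul_mem _ (mem_invtSubmodule_pow hTX k hbT)
    have hcS : c ∈ S := S.smul_mem _ (mem_invtSubmodule_pow hSX k hbS)
    have hac : (D ^ k) (a - c) = 0 := by
      rw [map_sub, hc, map_smul, pow_apply_pow_apply_of_lie_eq_one h hbD,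
        ← Nat.cast_smul_eq_nsmul K, inv_smul_smul₀ (by exact_mod_cast k.factorial_ne_zero),
        sub_self]
    simpa using S.add_mem (ih (T.sub_mem haT hcT) hac) hcS

theorem mem_of_forall_mem_nilPart {ι : Type*} [Finite ι] [DecidableEq ι]
    {D X : ι → Module.End K M} (hD : Pairwise fun i j => Commute (D i) (D j))
    (hDX : ∀ i j, ⁅D i, X j⁆ = if i = j then 1 else 0) {T S : Submodule K M}
    (hTD : ∀ i, T ∈ (D i).invtSubmodule) (hTX : ∀ i, T ∈ (X i).invtSubmodule)
    (hSX : ∀ i, S ∈ (X i).invtSubmodule) (hker : ∀ a ∈ T, (∀ i, D i a = 0) → a ∈ S)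
    {a : M} (ha : a ∈ T) (hnil : ∀ i, a ∈ nilPart (D i)) : a ∈ S := by
  have := Fintype.ofFinite ι
  have hcomm {i j : ι} (hij : i ≠ j) : Commute (D i) (X j) := by
    rw [commute_iff_lie_eq, hDX, if_neg hij]
  suffices h : ∀ s : Finset ι, ∀ T : Submodule K M, (∀ i, T ∈ (D i).invtSubmodule) →
      (∀ i ∈ s, T ∈ (X i).invtSubmodule) → (∀ a ∈ T, (∀ i ∈ s, D i a = 0) → a ∈ S) →
      ∀ a ∈ T, (∀ i ∈ s, a ∈ nilPart (D i)) → a ∈ S from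
    h Finset.univ T hTD (fun i _ => hTX i) (by simpa using hker) a ha fun i _ => hnil i
  intro s
  induction s using Finset.induction_on with
  | empty => exact fun T _ _ hker a ha _ => hker a ha (by simp)
  | insert i s his ih =>
    intro T hTD hTX hker a ha hnil
    have hne {j : ι} (hj : j ∈ s) : i ≠ j := (ne_of_mem_of_not_mem hj his).symm
    set N : Submodule K M := ⨅ j ∈ s, (D j).maxGenEigenspace 0 with hN
    have hmem_N {b : M} : b ∈ N ↔ ∀ j ∈ s, b ∈ nilPart (D j) := by
      simp only [hN, Submodule.mem_iInf, mem_nilPart_iff_mem_maxGenEigenspace]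
    have hND : N ∈ (D i).invtSubmodule :=
      iInf_maxGenEigenspace_mem_invtSubmodule_of_commute (fun j hj => hD (hne hj).symm) 0
    have hNX : N ∈ (X i).invtSubmodule :=
      iInf_maxGenEigenspace_mem_invtSubmodule_of_commute (fun j hj => hcomm (hne hj).symm) 0
    refine inf_maxGenEigenspace_le_of_lie_eq_one (by rw [hDX, if_pos rfl])
      (Module.End.invtSubmodule.inf_mem (hTD i) hND)
      (Module.End.invtSubmodule.inf_mem (hTX i (s.mem_insert_self i)) hNX) (hSX i) ?_
      ⟨⟨ha, hmem_N.2 fun j hj => hnil j (Finset.mem_insert_of_mem hj)⟩,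
        mem_nilPart_iff_mem_maxGenEigenspace.1 (hnil i (s.mem_insert_self i))⟩
    rintro b ⟨⟨hbT, hbN⟩, hb⟩
    refine ih (T ⊓ LinearMap.ker (D i))
      (fun j => Module.End.invtSubmodule.inf_mem (hTD j) (ker_mem_invtSubmodule_of_commute ?_))
      (fun j hj => Module.End.invtSubmodule.inf_mem (hTX j (Finset.mem_insert_of_mem hj))
        (ker_mem_invtSubmodule_of_commute (hcomm (hne hj))))
      (fun c hc hcs => hker c hc.1 (Finset.forall_mem_insert .. |>.2 ⟨hc.2, hcs⟩))
      b ⟨hbT, hb⟩ (hmem_N.1 hbN)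
    rcases eq_or_ne i j with rfl | hij
    exacts [Commute.refl _, hD hij]

end Taylor

section Derivations

variable {K R : Type*} [Field K] [Ring R] [Algebra K R]

/-- `D` is a derivation of the possibly noncommutative algebra `R`. -/
def IsDerivation (D : Module.End K R) : Prop :=
  ∀ a b, D (a * b) = D a * b + a * D b

namespace IsDerivation

variable {D E : Module.End K R}

theorem map_one (hD : IsDerivation D) : D 1 = 0 := by
  simpa using hD 1 1

theorem map_algebraMap (hD : IsDerivation D) (r : K) : D (algebraMap K R r) = 0 := by
  rw [Algebra.algebraMap_eq_smul_one, map_smul, hD.map_one, smul_zero]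

theorem conj {S : Type*} [Ring S] [Algebra K S] (hD : IsDerivation D) (e : R ≃ₐ[K] S) :
    IsDerivation (e.toLinearEquiv.conj D) := fun a b => by
  simp [LinearEquiv.conj_apply, hD (e.symm a)]

protected theorem lie (hD : IsDerivation D) (hE : IsDerivation E) : IsDerivation ⁅D, E⁆ := by
  intro a b
  simp only [Ring.lie_def, LinearMap.sub_apply, Module.End.mul_apply, hD a b, hE a b, map_add,
    hD _ _, hE _ _]
  noncomm_ring

theorem lie_mulLeft (hD : IsDerivation D) (x : R) :
    ⁅D, LinearMap.mulLeft K x⁆ = LinearMap.mulLeft K (D x) := by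
  ext a
  simp [Ring.lie_def, hD x a]

theorem eq_of_adjoin_eq_top (hD : IsDerivation D) (hE : IsDerivation E) {s : Set R}
    (hs : Algebra.adjoin K s = ⊤) (h : ∀ a ∈ s, D a = E a) : D = E := by
  ext a
  have ha : a ∈ Algebra.adjoin K s := hs ▸ trivial
  induction ha using Algebra.adjoin_induction with
  | mem x hx => exact h x hx
  | algebraMap r => rw [hD.map_algebraMap, hE.map_algebraMap]
  | add x y _ _ hx hy => rw [map_add, map_add, hx, hy]
  | mul x y _ _ hx hy => rw [hD, hE, hx, hy]

theorem commute_of_adjoin_eq_top (hD : IsDerivation D) (hE : IsDerivation E) {s : Set R}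
    (hs : Algebra.adjoin K s = ⊤) (h : ∀ a ∈ s, D (E a) = E (D a)) : Commute D E := by
  rw [commute_iff_lie_eq]
  refine (hD.lie hE).eq_of_adjoin_eq_top (fun a b => by simp) hs fun a ha => ?_
  simp [Ring.lie_def, h a ha]

theorem pow_apply_mul (hD : IsDerivation D) (N : ℕ) (a b : R) :
    (D ^ N) (a * b) = ∑ ij ∈ Finset.HasAntidiagonal.antidiagonal N,
      N.choose ij.1 • ((D ^ ij.1) a * (D ^ ij.2) b) := by
  induction N with
  | zero => simp
  | succ N ih =>
    rw [Finset.sum_antidiagonal_choose_succ_nsmul (fun i j => (D ^ i) a * (D ^ j) b) N,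
      pow_succ', Module.End.mul_apply, ih, map_sum, ← Finset.sum_add_distrib]
    refine Finset.sum_congr rfl fun ij hij => ?_
    rw [map_nsmul, hD, ← Module.End.mul_apply, ← Module.End.mul_apply, ← pow_succ', ← pow_succ',
      nsmul_add, add_comm,
      Nat.choose_symm_of_eq_add (Finset.HasAntidiagonal.mem_antidiagonal.1 hij).symm]

theorem pow_apply_mul_eq_zero (hD : IsDerivation D) {d e N : ℕ} {a b : R} (ha : (D ^ d) a = 0)
    (hb : (D ^ e) b = 0) (hN : d + e ≤ N + 1) : (D ^ N) (a * b) = 0 := by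
  rw [hD.pow_apply_mul]
  refine Finset.sum_eq_zero fun ⟨i, j⟩ hij => ?_
  rw [Finset.HasAntidiagonal.mem_antidiagonal] at hij
  rcases le_or_gt d i with h | h
  · rw [Module.End.pow_map_zero_of_le h ha, zero_mul, smul_zero]
  · rw [Module.End.pow_map_zero_of_le (by lia : e ≤ j) hb, mul_zero, smul_zero]

theorem pow_add_apply_mul (hD : IsDerivation D) {d e : ℕ} {a b : R} (ha : (D ^ (d + 1)) a = 0)
    (hb : (D ^ (e + 1)) b = 0) :
    (D ^ (d + e)) (a * b) = (d + e).choose d • ((D ^ d) a * (D ^ e) b) := by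
  rw [hD.pow_apply_mul, Finset.sum_eq_single_of_mem (d, e) (by simp)]
  rintro ⟨i, j⟩ hij hne
  rw [Finset.HasAntidiagonal.mem_antidiagonal] at hij
  rcases lt_trichotomy i d with h | rfl | h
  · rw [Module.End.pow_map_zero_of_le (by lia : e + 1 ≤ j) hb, mul_zero, smul_zero]
  · exact (hne (Prod.ext rfl (Nat.add_left_cancel hij))).elim
  · rw [Module.End.pow_map_zero_of_le (by lia : d + 1 ≤ i) ha, zero_mul, smul_zero]

/-- The subalgebra of elements on which a derivation is nilpotent. -/
def nilSubalgebra (hD : IsDerivation D) : Subalgebra K R where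
  carrier := nilPart D
  mul_mem' := by
    simp only [mem_nilPart_iff]
    rintro a b ⟨k, hk⟩ ⟨l, hl⟩
    exact ⟨k + l, hD.pow_apply_mul_eq_zero hk hl (by lia)⟩
  add_mem' := by
    simp only [mem_nilPart_iff_mem_maxGenEigenspace]
    exact add_mem
  algebraMap_mem' r := ⟨1, hD.map_algebraMap r⟩

end IsDerivation

theorem isDerivation_mulLeft_sub_mulRight (u : R) :
    IsDerivation (LinearMap.mulLeft K u - LinearMap.mulRight K u) := by
  intro a b
  simp only [LinearMap.sub_apply, LinearMap.mulLeft_apply, LinearMap.mulRight_apply]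
  noncomm_ring

section HasNilDegree

variable [CharZero K] [NoZeroDivisors R] {D : Module.End K R} {a b : R} {d e : ℕ}

theorem HasNilDegree.mul (hD : IsDerivation D) (ha : HasNilDegree D a d)
    (hb : HasNilDegree D b e) : HasNilDegree D (a * b) (d + e) := by
  refine ⟨?_, hD.pow_apply_mul_eq_zero ha.2 hb.2 (by lia)⟩
  rw [hD.pow_add_apply_mul ha.2 hb.2, ← Nat.cast_smul_eq_nsmul K]
  exact smul_ne_zero (by exact_mod_cast (Nat.choose_pos (by lia)).ne') (mul_ne_zero ha.1 hb.1)

theorem HasNilDegree.pow [Nontrivial R] (hD : IsDerivation D) (ha : HasNilDegree D a d) (k : ℕ) :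
    HasNilDegree D (a ^ k) (k * d) := by
  induction k with
  | zero => simp [HasNilDegree, hD.map_one]
  | succ k ih => rw [pow_succ, Nat.succ_mul]; exact ih.mul hD ha

end HasNilDegree

end Derivations

section Dimension

variable {K M : Type*} [Field K] [AddCommGroup M] [Module K M]

theorem finrank_map_add_finrank_inf_ker (f : Module.End K M) (W : Submodule K M)
    [FiniteDimensional K W] :
    Module.finrank K (W.map f) + Module.finrank K (W ⊓ LinearMap.ker f : Submodule K M) =
      Module.finrank K W := by
  rw [← LinearMap.finrank_range_add_finrank_ker (f.domRestrict W), LinearMap.range_domRestrict,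
    LinearMap.ker_domRestrict, ← Submodule.map_comap_subtype, Submodule.finrank_map_subtype_eq]

theorem finrank_le_mul_finrank_inf_ker {f : Module.End K M} {k : ℕ} {W : Submodule K M}
    [FiniteDimensional K W] (hW : W ∈ f.invtSubmodule) (hk : W ≤ LinearMap.ker (f ^ k)) :
    Module.finrank K W ≤ k * Module.finrank K (W ⊓ LinearMap.ker f : Submodule K M) := by
  induction k generalizing W with
  | zero =>
    have : W = ⊥ := by simpa [Module.End.one_eq_id] using hk
    simp [this]
  | succ k ih =>
    have hle : W.map f ≤ W := Submodule.map_le_iff_le_comap.2 hW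
    have hmap := ih (W := W.map f) (Submodule.map_mono hle |> Submodule.map_le_iff_le_comap.1)
      (Submodule.map_le_iff_le_comap.2 fun a ha => by
        simpa [pow_succ] using hk ha)
    have hinf : Module.finrank K (W.map f ⊓ LinearMap.ker f : Submodule K M) ≤
        Module.finrank K (W ⊓ LinearMap.ker f : Submodule K M) :=
      Submodule.finrank_mono (inf_le_inf_right _ hle)
    calc Module.finrank K W
        = Module.finrank K (W.map f) + Module.finrank K (W ⊓ LinearMap.ker f : Submodule K M) :=
          (finrank_map_add_finrank_inf_ker f W).symm
      _ ≤ (k + 1) * Module.finrank K (W ⊓ LinearMap.ker f : Submodule K M) := by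
          rw [add_one_mul]
          gcongr
          exact hmap.trans (Nat.mul_le_mul_left k hinf)

theorem finrank_le_pow_mul_finrank_inf_iInf_ker {ι : Type*} [Fintype ι] {D : ι → Module.End K M}
    (hD : Pairwise fun i j => Commute (D i) (D j)) {k : ℕ} {W : Submodule K M}
    [FiniteDimensional K W] (hW : ∀ i, W ∈ (D i).invtSubmodule)
    (hk : ∀ i, W ≤ LinearMap.ker (D i ^ k)) :
    Module.finrank K W ≤
      k ^ Fintype.card ι * Module.finrank K (W ⊓ ⨅ i, LinearMap.ker (D i) : Submodule K M) := by
  classical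
  suffices h : ∀ s : Finset ι, Module.finrank K W ≤
      k ^ s.card * Module.finrank K (W ⊓ s.inf fun i => LinearMap.ker (D i) : Submodule K M) by
    rw [← Finset.inf_univ_eq_iInf]
    exact h Finset.univ
  intro s
  induction s using Finset.induction_on with
  | empty => rw [Finset.inf_empty, inf_top_eq, Finset.card_empty, pow_zero, one_mul]
  | insert i s hi ih =>
    set U : Submodule K M := W ⊓ s.inf fun j => LinearMap.ker (D j)
    have hUD : U ∈ (D i).invtSubmodule := by
      refine Module.End.invtSubmodule.inf_mem (hW i) fun a ha => ?_
      simp only [Submodule.mem_comap, Submodule.mem_finsetInf] at ha ⊢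
      exact fun j hj => ker_mem_invtSubmodule_of_commute
        (hD (ne_of_mem_of_not_mem hj hi)) (ha j hj)
    calc Module.finrank K W ≤ k ^ s.card * Module.finrank K U := ih
      _ ≤ k ^ s.card * (k * Module.finrank K (U ⊓ LinearMap.ker (D i) : Submodule K M)) :=
          Nat.mul_le_mul_left _ (finrank_le_mul_finrank_inf_ker hUD (inf_le_left.trans (hk i)))
      _ = _ := by
          rw [Finset.card_insert_of_notMem hi, pow_succ, mul_assoc, Finset.inf_insert,
            inf_comm (LinearMap.ker (D i)), ← inf_assoc]

end Dimension

section Filtration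

variable {K R : Type*} [Field K] [Ring R] [Algebra K R]

theorem IsDerivation.pow_succ_le_comap {E : Module.End K R} (hE : IsDerivation E)
    {V : Submodule K R} (hV : V ≤ Submodule.comap E 1) (N : ℕ) :
    V ^ (N + 1) ≤ (V ^ N).comap E := by
  induction N with
  | zero => simpa using hV
  | succ N ih =>
    rw [pow_succ', Submodule.mul_le]
    intro u hu w hw
    rw [Submodule.mem_comap, hE]
    refine add_mem ?_ ?_
    · simpa only [one_mul] using Submodule.mul_mem_mul (show E u ∈ 1 from hV hu) hw
    · rw [pow_succ']
      exact Submodule.mul_mem_mul hu (ih hw)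

theorem IsDerivation.pow_le_ker_pow {E : Module.End K R} (hE : IsDerivation E)
    {V : Submodule K R} (hV : V ≤ Submodule.comap E 1) (N : ℕ) :
    V ^ N ≤ LinearMap.ker (E ^ (N + 1)) := by
  induction N with
  | zero =>
    intro v hv
    obtain ⟨c, rfl⟩ := Submodule.mem_one.1 (by simpa using hv)
    simp [hE.map_algebraMap]
  | succ N ih =>
    intro v hv
    rw [LinearMap.mem_ker, pow_succ, Module.End.mul_apply]
    exact ih (hE.pow_succ_le_comap hV N hv)

variable {ι : Type*}

/-- The span of `1` and the generators `x i`; its powers filter the algebra generated by them. -/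
def genSpan (K : Type*) {R ι : Type*} [Field K] [Ring R] [Algebra K R] (x : ι → R) :
    Submodule K R :=
  Submodule.span K (insert 1 (Set.range x))

theorem one_le_genSpan (x : ι → R) : 1 ≤ genSpan K x :=
  Submodule.one_le.2 (Submodule.subset_span (Set.mem_insert _ _))

theorem mem_genSpan (x : ι → R) (i : ι) : x i ∈ genSpan K x :=
  Submodule.subset_span (Set.mem_insert_of_mem _ ⟨i, rfl⟩)

theorem genSpan_le_iff {x : ι → R} {U : Submodule K R} :
    genSpan K x ≤ U ↔ 1 ∈ U ∧ ∀ i, x i ∈ U := by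
  rw [genSpan, Submodule.span_le, Set.insert_subset_iff, Set.range_subset_iff]
  rfl

theorem genSpan_le_comap {E : Module.End K R} (hE : IsDerivation E) {x : ι → R}
    (hx : ∀ i, E (x i) ∈ (1 : Submodule K R)) : genSpan K x ≤ Submodule.comap E 1 :=
  genSpan_le_iff.2 ⟨by rw [Submodule.mem_comap, hE.map_one]; exact zero_mem _, hx⟩

instance finiteDimensional_genSpan_pow [Finite ι] (x : ι → R) (N : ℕ) :
    FiniteDimensional K (genSpan K x ^ N : Submodule K R) := by
  have h : (genSpan K x).FG := Submodule.fg_span ((Set.finite_range x).insert 1)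
  exact Module.Finite.iff_fg.2 (h.pow N)

theorem exists_mem_genSpan_pow {x : ι → R} (hx : Algebra.adjoin K (Set.range x) = ⊤) (a : R) :
    ∃ N, a ∈ genSpan K x ^ N := by
  have hmono {k l : ℕ} (hkl : k ≤ l) : genSpan K x ^ k ≤ genSpan K x ^ l :=
    pow_le_pow_right₀ (one_le_genSpan x) hkl
  have ha : a ∈ Algebra.adjoin K (Set.range x) := hx ▸ trivial
  induction ha using Algebra.adjoin_induction with
  | mem y hy =>
    obtain ⟨i, rfl⟩ := hy
    exact ⟨1, by rw [pow_one]; exact mem_genSpan x i⟩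
  | algebraMap r => exact ⟨0, by rw [pow_zero]; exact Submodule.mem_one.2 ⟨r, rfl⟩⟩
  | add a b _ _ ha hb =>
    obtain ⟨k, hk⟩ := ha
    obtain ⟨l, hl⟩ := hb
    exact ⟨k + l, add_mem (hmono (by lia) hk) (hmono (by lia) hl)⟩
  | mul a b _ _ ha hb =>
    obtain ⟨k, hk⟩ := ha
    obtain ⟨l, hl⟩ := hb
    exact ⟨k + l, by rw [pow_add]; exact Submodule.mul_mem_mul hk hl⟩

end Filtration

/-- The Euler operator `∑ i, x i * D i`. -/
def euler {K R ι : Type*} [Field K] [Ring R] [Algebra K R] [Fintype ι] (x : ι → R)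
    (D : ι → Module.End K R) : Module.End K R :=
  ∑ i, LinearMap.mulLeft K (x i) * D i

theorem euler_apply {K R ι : Type*} [Field K] [Ring R] [Algebra K R] [Fintype ι] (x : ι → R)
    (D : ι → Module.End K R) (a : R) : euler x D a = ∑ i, x i * D i a := by
  simp [euler, LinearMap.sum_apply]

/-- The `D i` are partial derivatives with respect to algebra generators `x i` whose commutators
are scalars. -/
structure IsCoord {K R ι : Type*} [Field K] [Ring R] [Algebra K R] [DecidableEq ι] (x : ι → R)
    (D : ι → Module.End K R) : Prop where
  isDerivation : ∀ i, IsDerivation (D i)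
  apply : ∀ i j, D i (x j) = if i = j then 1 else 0
  lie_mem_one : ∀ i j, ⁅x i, x j⁆ ∈ (1 : Submodule K R)
  adjoin_eq_top : Algebra.adjoin K (Set.range x) = ⊤

namespace IsCoord

variable {K R ι : Type*} [Field K] [Ring R] [Algebra K R] [DecidableEq ι] {x : ι → R}
  {D : ι → Module.End K R}

theorem apply_mem_one (h : IsCoord x D) (i j : ι) : D i (x j) ∈ (1 : Submodule K R) := by
  rw [h.apply]
  split_ifs
  exacts [Submodule.one_le.1 le_rfl, zero_mem _]

theorem genSpan_le_comap (h : IsCoord x D) (i : ι) : genSpan K x ≤ Submodule.comap (D i) 1 :=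
  WeylPoly.genSpan_le_comap (h.isDerivation i) (h.apply_mem_one i)

theorem commute (h : IsCoord x D) (i j : ι) : Commute (D i) (D j) := by
  refine (h.isDerivation i).commute_of_adjoin_eq_top (h.isDerivation j) h.adjoin_eq_top ?_
  rintro _ ⟨k, rfl⟩
  obtain ⟨b, hb⟩ := Submodule.mem_one.1 (h.apply_mem_one i k)
  obtain ⟨c, hc⟩ := Submodule.mem_one.1 (h.apply_mem_one j k)
  rw [← hb, ← hc, (h.isDerivation i).map_algebraMap, (h.isDerivation j).map_algebraMap]

theorem mem_nilPart (h : IsCoord x D) (i : ι) (a : R) : a ∈ nilPart (D i) := by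
  obtain ⟨N, hN⟩ := exists_mem_genSpan_pow h.adjoin_eq_top a
  exact mem_nilPart_iff.2
    ⟨N + 1, (h.isDerivation i).pow_le_ker_pow (h.genSpan_le_comap i) N hN⟩

theorem lie_mem_one_of_mem_genSpan (h : IsCoord x D) (i : ι) {u : R} (hu : u ∈ genSpan K x) :
    ⁅x i, u⁆ ∈ (1 : Submodule K R) :=
  WeylPoly.genSpan_le_comap (isDerivation_mulLeft_sub_mulRight (x i)) (h.lie_mem_one i) hu

section Euler

variable [Fintype ι]

theorem euler_mul (h : IsCoord x D) (u w : R) :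
    euler x D (u * w) = euler x D u * w + u * euler x D w + ∑ i, ⁅x i, u⁆ * D i w := by
  simp only [euler_apply, Finset.sum_mul, Finset.mul_sum, ← Finset.sum_add_distrib]
  refine Finset.sum_congr rfl fun i _ => ?_
  rw [h.isDerivation, Ring.lie_def]
  noncomm_ring

theorem euler_sub_mem_one (h : IsCoord x D) {u : R} (hu : u ∈ genSpan K x) :
    euler x D u - u ∈ (1 : Submodule K R) := by
  have hle : genSpan K x ≤ Submodule.comap (euler x D - 1) 1 := by
    refine genSpan_le_iff.2 ⟨?_, fun j => ?_⟩
    · simpa [euler_apply, (h.isDerivation _).map_one] using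
        (Submodule.one_le.1 le_rfl : (1 : R) ∈ (1 : Submodule K R))
    · simp [euler_apply, h.apply]
  exact hle hu

theorem euler_sub_mem_genSpan_pow (h : IsCoord x D) (N : ℕ) {v : R}
    (hv : v ∈ genSpan K x ^ (N + 1)) : euler x D v - (N + 1) • v ∈ genSpan K x ^ N := by
  suffices hle : genSpan K x ^ (N + 1) ≤
      (genSpan K x ^ N).comap (euler x D - (N + 1) • (1 : Module.End K R)) from hle hv
  clear hv
  induction N with
  | zero => exact fun u hu => by simpa using h.euler_sub_mem_one (by simpa using hu)
  | succ N ih =>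
    rw [pow_succ', Submodule.mul_le]
    intro u hu w hw
    have hsplit : euler x D (u * w) - (N + 1 + 1) • (u * w) = (euler x D u - u) * w +
        u * (euler x D w - (N + 1) • w) + ∑ i, ⁅x i, u⁆ * D i w := by
      rw [h.euler_mul, succ_nsmul, ← mul_smul_comm]
      noncomm_ring
    change euler x D (u * w) - (N + 1 + 1) • (u * w) ∈ genSpan K x ^ (N + 1)
    rw [hsplit]
    refine Submodule.add_mem _ (Submodule.add_mem _ ?_ ?_) (Submodule.sum_mem _ fun i _ => ?_)
    · simpa only [one_mul] using Submodule.mul_mem_mul (h.euler_sub_mem_one hu) hw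
    · rw [pow_succ']
      exact Submodule.mul_mem_mul hu (ih hw)
    · have hpow : genSpan K x ^ N ≤ genSpan K x ^ (N + 1) :=
        pow_le_pow_right₀ (one_le_genSpan x) N.le_succ
      have hDw : D i w ∈ genSpan K x ^ N :=
        (h.isDerivation i).pow_succ_le_comap (h.genSpan_le_comap i) N hw
      refine hpow ?_
      simpa only [one_mul] using Submodule.mul_mem_mul (h.lie_mem_one_of_mem_genSpan i hu) hDw

end Euler

variable [CharZero K]

theorem iInf_ker [Finite ι] (h : IsCoord x D) : ⨅ i, LinearMap.ker (D i) = (1 : Submodule K R) := by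
  have := Fintype.ofFinite ι
  refine le_antisymm (fun a ha => ?_) fun a ha => ?_
  · simp only [Submodule.mem_iInf, LinearMap.mem_ker] at ha
    obtain ⟨N, hN⟩ := exists_mem_genSpan_pow h.adjoin_eq_top a
    induction N with
    | zero => simpa using hN
    | succ N ih =>
      have hmem := h.euler_sub_mem_genSpan_pow N hN
      simp only [euler_apply, ha, mul_zero, Finset.sum_const_zero, zero_sub, neg_mem_iff,
        ← Nat.cast_smul_eq_nsmul K] at hmem
      exact ih ((Submodule.smul_mem_iff _ (by exact_mod_cast N.succ_ne_zero)).1 hmem)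
  · obtain ⟨c, rfl⟩ := Submodule.mem_one.1 ha
    simp [(h.isDerivation _).map_algebraMap]

theorem exists_algebraMap_eq [Finite ι] (h : IsCoord x D) {a : R} (ha : ∀ i, D i a = 0) :
    ∃ c : K, algebraMap K R c = a :=
  Submodule.mem_one.1 (h.iInf_ker ▸ Submodule.mem_iInf _ |>.2 ha)

/- If `a * b = 0`, the leading derivatives of `a` and `b` also multiply to zero, which reduces to
the case where `a` is a scalar. -/
theorem noZeroDivisors [Finite ι] [Nontrivial R] (h : IsCoord x D) : NoZeroDivisors R := by
  refine ⟨fun {a b} hab => or_iff_not_imp_left.2 fun ha => by_contra fun hb => ?_⟩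
  obtain ⟨c, ⟨e, he, hce⟩, hc, hcD⟩ := exists_ne_zero_forall_apply_eq_zero
    (fun i j _ => h.commute i j) h.mem_nilPart (Q := {a | ∃ b, b ≠ 0 ∧ a * b = 0}) (by
      rintro i a ⟨b, hb, hab⟩ d hd
      obtain ⟨e, he⟩ := exists_hasNilDegree hb (h.mem_nilPart i b)
      refine ⟨_, he.1, ?_⟩
      have hlead := (h.isDerivation i).pow_add_apply_mul hd.2 he.2
      rw [hab, map_zero, eq_comm, ← Nat.cast_smul_eq_nsmul K] at hlead
      exact (smul_eq_zero.1 hlead).resolve_left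
        (by exact_mod_cast (Nat.choose_pos (by lia)).ne')) ⟨b, hb, hab⟩ ha
  obtain ⟨r, rfl⟩ := h.exists_algebraMap_eq hcD
  rw [← Algebra.smul_def, smul_eq_zero] at hce
  rcases hce with rfl | hce
  · exact hc (map_zero _)
  · exact he hce

theorem finrank_genSpan_pow_le [Fintype ι] (h : IsCoord x D) (N : ℕ) :
    Module.finrank K (genSpan K x ^ N : Submodule K R) ≤ (N + 1) ^ Fintype.card ι := by
  have hle := finrank_le_pow_mul_finrank_inf_iInf_ker (fun i j _ => h.commute i j)
    (W := genSpan K x ^ N) (k := N + 1)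
    (fun i => (pow_le_pow_right₀ (one_le_genSpan x) N.le_succ).trans
      ((h.isDerivation i).pow_succ_le_comap (h.genSpan_le_comap i) N))
    (fun i => (h.isDerivation i).pow_le_ker_pow (h.genSpan_le_comap i) N)
  refine hle.trans (mul_le_of_le_one_right (Nat.zero_le _) ?_)
  rw [h.iInf_ker]
  have hone : Module.finrank K (1 : Submodule K R) ≤ 1 := by
    rw [Submodule.one_eq_span]
    simpa using finrank_span_le_card (R := K) ({1} : Set R)
  have : FiniteDimensional K (1 : Submodule K R) := by
    rw [Submodule.one_eq_span]; infer_instance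
  exact (Submodule.finrank_mono inf_le_right).trans hone

end IsCoord

section Counting

variable {K R : Type*} [Field K] [Ring R] [Algebra K R]

/-- The span of the powers of `y` with exponent less than `N`. -/
def powersSpan (K : Type*) {R : Type*} [Field K] [Ring R] [Algebra K R] (y : R) (N : ℕ) :
    Submodule K R :=
  Submodule.span K (Set.range fun i : Fin N => y ^ (i : ℕ))

theorem powersSpan_fg (y : R) (N : ℕ) : (powersSpan K y N).FG :=
  Submodule.fg_span (Set.finite_range _)

theorem powersSpan_le_pow {V : Submodule K R} (hV : 1 ≤ V) {y : R} (hy : y ∈ V) (N : ℕ) :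
    powersSpan K y N ≤ V ^ N := by
  rw [powersSpan, Submodule.span_le]
  rintro _ ⟨i, rfl⟩
  exact pow_le_pow_right₀ hV i.2.le (Submodule.pow_mem_pow V hy i)

theorem mul_le_ker {E : Module.End K R} (hE : IsDerivation E) {U V : Submodule K R}
    (hU : U ≤ LinearMap.ker E) (hV : V ≤ LinearMap.ker E) : U * V ≤ LinearMap.ker E :=
  Submodule.mul_le.2 fun u hu v hv => by
    rw [LinearMap.mem_ker, hE, show E u = 0 from hU hu, show E v = 0 from hV hv, zero_mul,
      mul_zero, add_zero]

theorem powersSpan_le_ker {E : Module.End K R} (hE : IsDerivation E) {y : R} (hy : E y = 0)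
    (N : ℕ) : powersSpan K y N ≤ LinearMap.ker E := by
  rw [powersSpan, Submodule.span_le]
  rintro _ ⟨i, rfl⟩
  change E (y ^ (i : ℕ)) = 0
  induction (i : ℕ) with
  | zero => rw [pow_zero, hE.map_one]
  | succ k ih => rw [pow_succ, hE, ih, hy, zero_mul, mul_zero, add_zero]

variable [CharZero K] [Nontrivial R] [NoZeroDivisors R] {E : Module.End K R}

/- `E ^ (N * d)` annihilates every summand of degree less than `N` in `y`. -/
theorem eq_zero_of_sum_pow_mul_eq_zero (hE : IsDerivation E) {y : R} {d : ℕ} (hd : 0 < d)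
    (hy : HasNilDegree E y d) {N : ℕ} {w : Fin N → R} (hw : ∀ i, E (w i) = 0)
    (h : ∑ i : Fin N, y ^ (i : ℕ) * w i = 0) (i : Fin N) : w i = 0 := by
  induction N with
  | zero => exact i.elim0
  | succ N ih =>
    have hlow (i : Fin N) : (E ^ (N * d)) (y ^ (i : ℕ) * w i.castSucc) = 0 :=
      hE.pow_apply_mul_eq_zero (hy.pow hE i).2 (e := 1) (hw _) (by nlinarith [i.2])
    have htop : (E ^ (N * d)) (y ^ N * w (Fin.last N)) =
        (E ^ (N * d)) (y ^ N) * w (Fin.last N) := by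
      simpa using hE.pow_add_apply_mul (hy.pow hE N).2 (e := 0) (by simpa using hw (Fin.last N))
    have hlast : w (Fin.last N) = 0 := by
      have := congr((E ^ (N * d)) $h)
      simp only [Fin.sum_univ_castSucc, Fin.val_castSucc, Fin.val_last, map_add, map_sum, hlow,
        Finset.sum_const_zero, zero_add, htop, map_zero, mul_eq_zero] at this
      exact this.resolve_left (hy.pow hE N).1
    rw [Fin.sum_univ_castSucc, hlast, mul_zero, add_zero] at h
    exact Fin.lastCases hlast (ih (fun i => hw _) h) i

theorem mul_finrank_le_finrank_powersSpan_mul (hE : IsDerivation E) {y : R} (hy : E y ≠ 0)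
    (hnil : y ∈ nilPart E) {W : Submodule K R} (hW : W.FG) (hWE : W ≤ LinearMap.ker E) (N : ℕ) :
    N * Module.finrank K W ≤ Module.finrank K (powersSpan K y N * W : Submodule K R) := by
  obtain ⟨d, hd⟩ := exists_hasNilDegree (fun h0 => hy (by rw [h0, map_zero])) hnil
  have hd0 : 0 < d := Nat.pos_of_ne_zero fun h0 => hy (by simpa [h0] using hd.2)
  have : FiniteDimensional K W := Module.Finite.iff_fg.2 hW
  have : FiniteDimensional K (powersSpan K y N * W : Submodule K R) :=
    Module.Finite.iff_fg.2 ((powersSpan_fg y N).mul hW)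
  set φ : (Fin N → W) →ₗ[K] R :=
    ∑ i : Fin N, LinearMap.mulLeft K (y ^ (i : ℕ)) ∘ₗ W.subtype ∘ₗ LinearMap.proj i with hφ
  have hφ_apply (w : Fin N → W) : φ w = ∑ i : Fin N, y ^ (i : ℕ) * (w i : R) := by
    simp [hφ, LinearMap.sum_apply]
  have hinj : Function.Injective φ := by
    rw [injective_iff_map_eq_zero]
    intro w hw
    rw [hφ_apply] at hw
    ext i
    exact eq_zero_of_sum_pow_mul_eq_zero hE hd0 hd (fun i => hWE (w i).2) hw i
  have hrange : LinearMap.range φ ≤ powersSpan K y N * W := by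
    rintro _ ⟨w, rfl⟩
    rw [hφ_apply]
    exact Submodule.sum_mem _ fun i _ =>
      Submodule.mul_mem_mul (Submodule.subset_span ⟨i, rfl⟩) (w i).2
  calc N * Module.finrank K W = Module.finrank K (LinearMap.range φ) := by
        rw [LinearMap.finrank_range_of_inj hinj, Module.finrank_pi_fintype]; simp
    _ ≤ _ := Submodule.finrank_mono hrange

theorem pow_length_le_finrank_prod {l : List (Module.End K R × R)}
    (hder : ∀ p ∈ l, IsDerivation p.1) (hne : ∀ p ∈ l, p.1 p.2 ≠ 0)
    (hnil : ∀ p ∈ l, p.2 ∈ nilPart p.1) (htri : l.Pairwise fun p q => p.1 q.2 = 0) (N : ℕ) :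
    (l.map fun p => powersSpan K p.2 N).prod.FG ∧ N ^ l.length ≤
      Module.finrank K (l.map fun p => powersSpan K p.2 N).prod := by
  induction l with
  | nil =>
    rw [List.map_nil, List.prod_nil, Submodule.one_eq_span]
    exact ⟨Submodule.fg_span_singleton 1, by simp [finrank_span_singleton (one_ne_zero (α := R))]⟩
  | cons p l ih =>
    rw [List.forall_mem_cons] at hder hne hnil
    rw [List.pairwise_cons] at htri
    obtain ⟨hfg, hle⟩ := ih hder.2 hne.2 hnil.2 htri.2
    have hker : (l.map fun p => powersSpan K p.2 N).prod ≤ LinearMap.ker p.1 := by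
      refine List.prod_induction (· ≤ LinearMap.ker p.1) (fun _ _ => mul_le_ker hder.1) ?_ ?_
      · exact Submodule.one_le.2 hder.1.map_one
      · simp only [List.mem_map]
        rintro _ ⟨q, hq, rfl⟩
        exact powersSpan_le_ker hder.1 (htri.1 q hq) N
    rw [List.map_cons, List.prod_cons, List.length_cons, pow_succ']
    exact ⟨(powersSpan_fg _ _).mul hfg, (Nat.mul_le_mul_left N hle).trans
      (mul_finrank_le_finrank_powersSpan_mul hder.1 hne.1 hnil.1 hfg hker N)⟩

/- Gelfand–Kirillov dimension count: the products of powers of the `y`'s of degree `< N` are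
`N ^ l.length` independent elements of filtration degree `O(N)`, where there is only room for
`O(N) ^ card ι`. -/
theorem IsCoord.length_le_card {ι : Type*} [Fintype ι] [DecidableEq ι] {x : ι → R}
    {D : ι → Module.End K R} (h : IsCoord x D) {l : List (Module.End K R × R)}
    (hder : ∀ p ∈ l, IsDerivation p.1) (hne : ∀ p ∈ l, p.1 p.2 ≠ 0)
    (hnil : ∀ p ∈ l, p.2 ∈ nilPart p.1) (htri : l.Pairwise fun p q => p.1 q.2 = 0) :
    l.length ≤ Fintype.card ι := by
  set V := genSpan K x
  obtain ⟨r, hr⟩ : ∃ r, ∀ p ∈ l, p.2 ∈ V ^ r := by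
    choose r hr using exists_mem_genSpan_pow h.adjoin_eq_top
    refine ⟨(l.map fun p => r p.2).sum, fun p hp => pow_le_pow_right₀ (one_le_genSpan x) ?_ (hr _)⟩
    exact List.single_le_sum (by simp) _ (List.mem_map_of_mem hp)
  have hbound (N : ℕ) : N ^ l.length ≤ (r * N * l.length + 1) ^ Fintype.card ι := by
    have hprod : (l.map fun p => powersSpan K p.2 N).prod ≤ V ^ (r * N * l.length) := by
      rw [pow_mul, pow_mul]
      simpa using List.prod_le_pow_card (l.map fun p => powersSpan K p.2 N) ((V ^ r) ^ N) (by
        simp only [List.mem_map]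
        rintro _ ⟨p, hp, rfl⟩
        exact powersSpan_le_pow (one_le_pow₀ (one_le_genSpan x)) (hr p hp) N)
    exact (pow_length_le_finrank_prod hder hne hnil htri N).2.trans
      ((Submodule.finrank_mono hprod).trans (h.finrank_genSpan_pow_le _))
  by_contra! hlt
  set s := Fintype.card ι
  set t := r * l.length + 1
  set N := t ^ s + 1
  have hle : N ^ (s + 1) ≤ (t * N) ^ s :=
    (Nat.pow_le_pow_right (by lia) hlt).trans ((hbound N).trans
      (Nat.pow_le_pow_left (by rw [show t * N = r * N * l.length + N by ring]; lia) s))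
  rw [mul_pow, pow_succ'] at hle
  have := Nat.le_of_mul_le_mul_right hle (pow_pos (Nat.succ_pos _) s)
  lia

end Counting

section WeylFamilies

variable {K R κ : Type*} [Field K] [Ring R] [Algebra K R]

/-- The canonical conjugates of `(q, p) = (u ∘ Sum.inl, u ∘ Sum.inr)`, namely `(p, -q)`. -/
def conjugate (u : κ ⊕ κ → R) : κ ⊕ κ → R :=
  Sum.elim (fun i => u (Sum.inr i)) fun i => -u (Sum.inl i)

/-- The elements `u (Sum.inl i)` and `u (Sum.inr i)` satisfy the defining relations of the
generators `q_i` and `p_i` of a Weyl algebra. -/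
def IsWeylFamily [DecidableEq κ] (u : κ ⊕ κ → R) : Prop :=
  ∀ b c, ⁅conjugate u b, u c⁆ = if b = c then 1 else 0

/-- The partial derivatives `[p_i, ·]` and `-[q_i, ·]` attached to a Weyl family. -/
def weylPartial (K : Type*) {R κ : Type*} [Field K] [Ring R] [Algebra K R] (u : κ ⊕ κ → R)
    (b : κ ⊕ κ) : Module.End K R :=
  LinearMap.mulLeft K (conjugate u b) - LinearMap.mulRight K (conjugate u b)

theorem weylPartial_eq_lie (u : κ ⊕ κ → R) (b : κ ⊕ κ) (a : R) :
    weylPartial K u b a = ⁅conjugate u b, a⁆ :=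
  rfl

theorem weylPartial_inr_apply (u : κ ⊕ κ → R) (i : κ) (a : R) :
    weylPartial K u (Sum.inr i) a = -(u (Sum.inl i) * a - a * u (Sum.inl i)) := by
  rw [weylPartial_eq_lie, conjugate, Sum.elim_inr, Ring.lie_def]
  noncomm_ring

theorem isDerivation_weylPartial (u : κ ⊕ κ → R) (b : κ ⊕ κ) :
    IsDerivation (weylPartial K u b) :=
  isDerivation_mulLeft_sub_mulRight _

theorem forall_weylPartial_eq_zero_iff {u : κ ⊕ κ → R} {a : R} :
    (∀ b, weylPartial K u b a = 0) ↔ ∀ b, Commute (u b) a := by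
  simp only [weylPartial_eq_lie, ← commute_iff_lie_eq, conjugate, Sum.forall, Sum.elim_inl,
    Sum.elim_inr, Commute.neg_left_iff, and_comm]

namespace IsWeylFamily

variable [DecidableEq κ] {u : κ ⊕ κ → R}

theorem of_lie (hpq : ∀ i j, ⁅u (Sum.inr i), u (Sum.inl j)⁆ = if i = j then 1 else 0)
    (hpp : ∀ i j, ⁅u (Sum.inr i), u (Sum.inr j)⁆ = 0)
    (hqq : ∀ i j, ⁅u (Sum.inl i), u (Sum.inl j)⁆ = 0) : IsWeylFamily u := by
  rintro (i | i) (j | j)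
  · simp [conjugate, hpq]
  · simp [conjugate, hpp]
  · simpa [conjugate, ← commute_iff_lie_eq] using hqq i j
  · simpa [conjugate, Ring.lie_def, sub_eq_neg_add, add_comm, eq_comm] using hpq j i

theorem map {S : Type*} [Ring S] [Algebra K S] (hu : IsWeylFamily u) (φ : R →ₐ[K] S) :
    IsWeylFamily (φ ∘ u) := by
  intro b c
  have hconj : conjugate (φ ∘ u) b = φ (conjugate u b) := by
    rcases b with b | b <;> simp [conjugate]
  rw [hconj, Function.comp_apply, Ring.lie_def, ← map_mul, ← map_mul, ← map_sub, ← Ring.lie_def,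
    hu, apply_ite φ, map_one, map_zero]

theorem weylPartial_apply (hu : IsWeylFamily u) (b c : κ ⊕ κ) :
    weylPartial K u b (u c) = if b = c then 1 else 0 :=
  hu b c

theorem mem_nilPart_weylPartial (hu : IsWeylFamily u) (b : κ ⊕ κ) :
    u b ∈ nilPart (weylPartial K u b) :=
  mem_nilPart_iff.2 ⟨2, by
    rw [pow_two, Module.End.mul_apply, hu.weylPartial_apply, if_pos rfl,
      (isDerivation_weylPartial u b).map_one]⟩

theorem lie_conjugate_mem_one (hu : IsWeylFamily u) (b c : κ ⊕ κ) :
    ⁅conjugate u b, u c⁆ ∈ (1 : Submodule K R) := by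
  rw [hu]
  split_ifs
  exacts [Submodule.one_le.1 le_rfl, zero_mem _]

theorem lie_mem_one (hu : IsWeylFamily u) (b c : κ ⊕ κ) : ⁅u b, u c⁆ ∈ (1 : Submodule K R) := by
  have hconj := hu.lie_conjugate_mem_one (K := K) b.swap c
  rcases b with b | b
  · rw [← neg_mem_iff]
    simpa only [conjugate, Sum.swap_inl, Sum.elim_inr, Ring.lie_def, neg_mul, mul_neg, neg_sub,
      sub_neg_eq_add, neg_add_eq_sub] using hconj
  · exact hconj

theorem commute_weylPartial (hu : IsWeylFamily u) (b c : κ ⊕ κ) :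
    Commute (weylPartial K u b) (weylPartial K u c) := by
  have hmem : ⁅conjugate u b, conjugate u c⁆ ∈ (1 : Submodule K R) := by
    have hconj := hu.lie_conjugate_mem_one (K := K) b c.swap
    rcases c with c | c
    · exact hconj
    · rw [← neg_mem_iff]
      simpa only [conjugate, Sum.swap_inr, Sum.elim_inr, Ring.lie_def, neg_mul, mul_neg, neg_sub,
        sub_neg_eq_add, neg_add_eq_sub] using hconj
  obtain ⟨r, hr⟩ := Submodule.mem_one.1 hmem
  refine LinearMap.ext fun a => sub_eq_zero.1 ?_
  calc weylPartial K u b (weylPartial K u c a) - weylPartial K u c (weylPartial K u b a)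
      = ⁅⁅conjugate u b, conjugate u c⁆, a⁆ := by
        simp only [weylPartial_eq_lie, Ring.lie_def]
        noncomm_ring
    _ = 0 := by rw [← hr, ← commute_iff_lie_eq]; exact Algebra.commute_algebraMap_left r a

theorem injective_of_forall_commute [Finite κ] {S : Type*} [Ring S] [Algebra K S]
    (hu : IsWeylFamily u) (hnil : ∀ b a, a ∈ nilPart (weylPartial K u b)) (φ : R →ₐ[K] S)
    (hφ : ∀ a, (∀ b, Commute (u b) a) → φ a = 0 → a = 0) : Function.Injective φ := by
  rw [injective_iff_map_eq_zero]
  intro a ha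
  by_contra ha0
  have hker (b : κ ⊕ κ) : LinearMap.ker φ.toLinearMap ∈ (weylPartial K u b).invtSubmodule := by
    intro a (ha : φ a = 0)
    change φ (conjugate u b * a - a * conjugate u b) = 0
    rw [map_sub, map_mul, map_mul, ha, mul_zero, zero_mul, sub_zero]
  obtain ⟨c, hc, hc0, hcu⟩ := exists_ne_zero_forall_apply_eq_zero
    (fun b c _ => hu.commute_weylPartial b c) hnil (Q := {a | φ a = 0})
    (fun b a ha d _ => mem_invtSubmodule_pow (hker b) d ha) ha ha0
  exact hc0 (hφ c (forall_weylPartial_eq_zero_iff.1 hcu) hc)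

end IsWeylFamily

/- Otherwise some `D (Sum.inl b)` is nonzero at `c`, and then `u`, `c` and the `x (Sum.inr l)` are
in triangular position although there is one more of them than there are coordinates. -/
theorem IsCoord.apply_inl_eq_zero_of_commute [CharZero K] [Nontrivial R] {γ : Type*} [Finite κ]
    [DecidableEq κ] [Finite γ] [DecidableEq γ] {x : (κ ⊕ κ) ⊕ γ → R}
    {D : (κ ⊕ κ) ⊕ γ → Module.End K R} (h : IsCoord x D) {u : κ ⊕ κ → R} (hu : IsWeylFamily u)
    (hux : ∀ b l, Commute (u b) (x (Sum.inr l))) {c : R} (hc : ∀ b, Commute (u b) c)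
    (b : κ ⊕ κ) : D (Sum.inl b) c = 0 := by
  have := Fintype.ofFinite κ
  have := Fintype.ofFinite γ
  have := h.noZeroDivisors
  have hux' (b : κ ⊕ κ) (l : γ) : weylPartial K u b (x (Sum.inr l)) = 0 :=
    forall_weylPartial_eq_zero_iff.2 (fun b => hux b l) b
  by_contra hb
  set lu := (Finset.univ : Finset (κ ⊕ κ)).toList.map fun b => (weylPartial K u b, u b) with hlu
  set lx := (Finset.univ : Finset γ).toList.map fun l => (D (Sum.inr l), x (Sum.inr l)) with hlx
  have hforall {P : Module.End K R × R → Prop} (hPu : ∀ b, P (weylPartial K u b, u b))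
      (hPc : P (D (Sum.inl b), c)) (hPx : ∀ l, P (D (Sum.inr l), x (Sum.inr l))) :
      ∀ p ∈ lu ++ (D (Sum.inl b), c) :: lx, P p := by
    simpa [hlu, hlx, or_imp, forall_and] using ⟨Sum.forall.1 hPu, hPc, hPx⟩
  have htri : (lu ++ (D (Sum.inl b), c) :: lx).Pairwise fun p q => p.1 q.2 = 0 := by
    rw [List.pairwise_append, List.pairwise_cons, hlu, hlx, List.pairwise_map, List.pairwise_map]
    refine ⟨(Finset.nodup_toList _).imp fun hne => by rw [hu.weylPartial_apply, if_neg hne],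
      ⟨by simp [h.apply], (Finset.nodup_toList _).imp fun hne => by simp [h.apply, hne]⟩, ?_⟩
    simp only [List.mem_map, List.mem_cons]
    rintro _ ⟨b', -, rfl⟩ _ (rfl | ⟨l, -, rfl⟩)
    exacts [forall_weylPartial_eq_zero_iff.2 hc b', hux' b' l]
  have hlen := h.length_le_card
    (hforall (isDerivation_weylPartial u) (h.isDerivation _) fun l => h.isDerivation _)
    (hforall (fun b => by simp [hu.weylPartial_apply]) hb fun l => by simp [h.apply])
    (hforall hu.mem_nilPart_weylPartial (h.mem_nilPart _ _) fun l => h.mem_nilPart _ _) htri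
  simp [hlu, hlx] at hlen

end WeylFamilies

section TaylorDerivations

variable {K R : Type*} [Field K] [CharZero K] [Ring R] [Algebra K R]

theorem mem_of_forall_mem_nilPart_of_isDerivation {ι : Type*} [Finite ι] [DecidableEq ι]
    {D : ι → Module.End K R} {x : ι → R} (hder : ∀ i, IsDerivation (D i))
    (hcomm : Pairwise fun i j => Commute (D i) (D j))
    (hDx : ∀ i j, D i (x j) = if i = j then 1 else 0) {T S : Submodule K R}
    (hTD : ∀ i, ∀ a ∈ T, D i a ∈ T) (hTx : ∀ i, ∀ a ∈ T, x i * a ∈ T)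
    (hSx : ∀ i, ∀ a ∈ S, x i * a ∈ S) (hker : ∀ a ∈ T, (∀ i, D i a = 0) → a ∈ S) {a : R}
    (ha : a ∈ T) (hnil : ∀ i, a ∈ nilPart (D i)) : a ∈ S :=
  mem_of_forall_mem_nilPart (X := fun i => LinearMap.mulLeft K (x i)) hcomm
    (fun i j => by
      rw [(hder i).lie_mulLeft, hDx, apply_ite (LinearMap.mulLeft K), LinearMap.mulLeft_one,
        LinearMap.mulLeft_zero_eq_zero]; rfl)
    hTD hTx hSx hker ha hnil

theorem IsCoord.mem_of_forall_apply_inl_eq_zero {κ γ : Type*} [DecidableEq κ] [Finite κ]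
    [DecidableEq γ] [Finite γ] {x : κ ⊕ γ → R} {D : κ ⊕ γ → Module.End K R} (h : IsCoord x D)
    {B : Subalgebra K R} (hxB : ∀ l, x (Sum.inr l) ∈ B) {a : R}
    (ha : ∀ b, D (Sum.inl b) a = 0) : a ∈ B := by
  refine mem_of_forall_mem_nilPart_of_isDerivation (D := fun l => D (Sum.inr l))
    (x := fun l => x (Sum.inr l)) (T := ⨅ b, LinearMap.ker (D (Sum.inl b)))
    (S := Subalgebra.toSubmodule B) (fun l => h.isDerivation _) (fun l l' _ => h.commute _ _)
    (fun l l' => by simp only [h.apply, Sum.inr.injEq]) ?_ ?_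
    (fun l a ha => B.mul_mem (hxB l) ha) ?_ (by simpa using ha) (fun l => h.mem_nilPart _ a)
  · simp only [Submodule.mem_iInf, LinearMap.mem_ker]
    intro l a ha b
    rw [← Module.End.mul_apply, (h.commute _ _).eq, Module.End.mul_apply, ha, map_zero]
  · simp only [Submodule.mem_iInf, LinearMap.mem_ker]
    intro l a ha b
    rw [h.isDerivation, h.apply, ha, if_neg Sum.inl_ne_inr, zero_mul, mul_zero, add_zero]
  · simp only [Submodule.mem_iInf, LinearMap.mem_ker]
    intro a ha hal
    obtain ⟨c, rfl⟩ := h.exists_algebraMap_eq (Sum.forall.2 ⟨ha, hal⟩)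
    exact B.algebraMap_mem c

theorem IsCoord.mem_of_forall_commute [Nontrivial R] {κ γ : Type*} [DecidableEq κ] [Finite κ]
    [DecidableEq γ] [Finite γ] {x : (κ ⊕ κ) ⊕ γ → R} {D : (κ ⊕ κ) ⊕ γ → Module.End K R}
    (h : IsCoord x D) {u : κ ⊕ κ → R} (hu : IsWeylFamily u)
    (hux : ∀ b l, Commute (u b) (x (Sum.inr l))) {B : Subalgebra K R}
    (hxB : ∀ l, x (Sum.inr l) ∈ B) {c : R} (hc : ∀ b, Commute (u b) c) : c ∈ B :=
  h.mem_of_forall_apply_inl_eq_zero hxB (h.apply_inl_eq_zero_of_commute hu hux hc)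

variable {κ : Type*} [DecidableEq κ] [Finite κ] {u : κ ⊕ κ → R}

theorem IsWeylFamily.mem_of_forall_mem_nilPart (hu : IsWeylFamily u) {T B : Subalgebra K R}
    (huT : ∀ b, u b ∈ T) (huB : ∀ b, u b ∈ B)
    (hker : ∀ a ∈ T, (∀ b, Commute (u b) a) → a ∈ B) {a : R} (ha : a ∈ T)
    (hnil : ∀ b, a ∈ nilPart (weylPartial K u b)) : a ∈ B := by
  have hconj (b : κ ⊕ κ) : conjugate u b ∈ T := by
    rcases b with b | b
    exacts [huT _, T.neg_mem (huT _)]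
  exact mem_of_forall_mem_nilPart_of_isDerivation (T := Subalgebra.toSubmodule T)
    (S := Subalgebra.toSubmodule B) (isDerivation_weylPartial u)
    (fun b c _ => hu.commute_weylPartial b c) hu.weylPartial_apply
    (fun b a ha => T.sub_mem (T.mul_mem (hconj b) ha) (T.mul_mem ha (hconj b)))
    (fun b a ha => T.mul_mem (huT b) ha) (fun b a ha => B.mul_mem (huB b) ha)
    (fun a haT ha => hker a haT (forall_weylPartial_eq_zero_iff.1 ha)) ha hnil

end TaylorDerivations

section Jacobian

open MvPolynomial Matrix

variable {k ι M : Type*} [CommRing k] [Fintype ι] [AddCommGroup M] [Module k M]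
  [Module (MvPolynomial ι k) M]

theorem derivation_apply_eq_sum_pderiv_smul (D : Derivation k (MvPolynomial ι k) M)
    (g : MvPolynomial ι k) : D g = ∑ l, pderiv l g • D (X l) := by
  classical
  induction g using MvPolynomial.induction_on with
  | C r => simp
  | add p q hp hq => simp only [map_add, hp, hq, add_smul, Finset.sum_add_distrib]
  | mul_X p i hp =>
    simp [hp, pderiv_X, Pi.single_apply, add_smul, Finset.sum_add_distrib, Finset.smul_sum,
      smul_smul]

/-- The Jacobian matrix `(∂ f_i / ∂ X_l)` of a family of polynomials. -/
def jacobianMatrix (f : ι → MvPolynomial ι k) : Matrix ι ι (MvPolynomial ι k) :=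
  Matrix.of fun i l => pderiv l (f i)

variable [DecidableEq ι] {f : ι → MvPolynomial ι k}

theorem derivation_eq_of_isUnit_det_jacobianMatrix (hf : IsUnit (jacobianMatrix f).det)
    {D E : Derivation k (MvPolynomial ι k) M} (h : ∀ i, D (f i) = E (f i)) : D = E := by
  have hDE (i : ι) : ∑ l, jacobianMatrix f i l • (D (X l) - E (X l)) = 0 := by
    simp only [jacobianMatrix, of_apply, smul_sub, Finset.sum_sub_distrib,
      ← derivation_apply_eq_sum_pderiv_smul, h, sub_self]
  refine MvPolynomial.derivation_ext fun l => sub_eq_zero.1 ?_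
  calc D (X l) - E (X l)
      = ∑ l', ((jacobianMatrix f)⁻¹ * jacobianMatrix f) l l' • (D (X l') - E (X l')) := by
        simp [Matrix.nonsing_inv_mul _ hf, Matrix.one_apply, ite_smul]
    _ = ∑ i, (jacobianMatrix f)⁻¹ l i • ∑ l', jacobianMatrix f i l' • (D (X l') - E (X l')) := by
        simp only [Matrix.mul_apply, Finset.sum_smul, Finset.smul_sum, mul_smul]
        exact Finset.sum_comm
    _ = 0 := by simp only [hDE, smul_zero, Finset.sum_const_zero]

/-- The partial derivative with respect to `f j`, for polynomials `f` whose Jacobian determinant is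
invertible. -/
def dualDerivation (f : ι → MvPolynomial ι k) (j : ι) :
    Derivation k (MvPolynomial ι k) (MvPolynomial ι k) :=
  mkDerivation k fun l => (jacobianMatrix f)⁻¹ l j

theorem dualDerivation_apply (f : ι → MvPolynomial ι k) (j : ι) (g : MvPolynomial ι k) :
    dualDerivation f j g = ∑ l, pderiv l g * (jacobianMatrix f)⁻¹ l j := by
  rw [derivation_apply_eq_sum_pderiv_smul]
  simp [dualDerivation]

variable (hf : IsUnit (jacobianMatrix f).det)
include hf

theorem dualDerivation_apply_self (i j : ι) :
    dualDerivation f j (f i) = if j = i then 1 else 0 := by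
  have h := congr_fun₂ (Matrix.mul_nonsing_inv _ hf) i j
  rw [Matrix.one_apply] at h
  simp only [dualDerivation_apply, eq_comm (a := j), ← h,
    Matrix.mul_apply, jacobianMatrix, of_apply]

theorem lie_dualDerivation (i j : ι) : ⁅dualDerivation f i, dualDerivation f j⁆ = 0 :=
  derivation_eq_of_isUnit_det_jacobianMatrix hf fun l => by
    simp [Derivation.commutator_apply, dualDerivation_apply_self hf, apply_ite]

theorem pderiv_apply_eq_sum_mul_dualDerivation (l : ι) (g : MvPolynomial ι k) :
    pderiv l g = ∑ j, pderiv l (f j) * dualDerivation f j g := by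
  have h : pderiv l = Derivation.mk' (∑ j, pderiv l (f j) • (dualDerivation f j).toLinearMap)
      fun a b => by simp [mul_add, Finset.sum_add_distrib, Finset.mul_sum, mul_left_comm] :=
    derivation_eq_of_isUnit_det_jacobianMatrix hf fun i => by
      simp [dualDerivation_apply_self hf]
  simpa using congr($h g)

end Jacobian

section PolynomialTaylor

open MvPolynomial

variable {K ι : Type*} [Field K]

theorem isDerivation_derivation {R : Type*} [CommRing R] [Algebra K R] (E : Derivation K R R) :
    IsDerivation E.toLinearMap := fun a b => by
  simp [mul_comm, add_comm]

variable [DecidableEq ι]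

theorem IsDerivation.apply_eq_algebraMap_dualDerivation {R S : Type*} [Fintype ι] [Ring R]
    [Algebra K R] [Algebra (MvPolynomial ι K) R] [Ring S] [Algebra K S] {f : ι → MvPolynomial ι K}
    (hf : IsUnit (jacobianMatrix f).det) {δ : Module.End K S} (hδ : IsDerivation δ) {j : ι}
    {φ : MvPolynomial ι K →ₐ[K] S} {ψ : S →ₐ[K] R}
    [IsScalarTower K (MvPolynomial ι K) R] (hψφ : ∀ g, ψ (φ g) = algebraMap _ R g)
    (h : ∀ i, ψ (δ (φ (f i))) = if j = i then 1 else 0) (g : MvPolynomial ι K) :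
    ψ (δ (φ g)) = algebraMap _ R (dualDerivation f j g) := by
  let D : Derivation K (MvPolynomial ι K) R :=
    .mk' (ψ.toLinearMap ∘ₗ δ ∘ₗ φ.toLinearMap) fun a b => by
      simp [hδ _ _, hψφ, Algebra.smul_def, add_comm, (Algebra.commute_algebraMap_right b _).eq]
  let E : Derivation K (MvPolynomial ι K) R :=
    (Algebra.linearMap _ R).compDer (dualDerivation f j)
  have hDE : D = E := derivation_eq_of_isUnit_det_jacobianMatrix hf fun i => by
    change ψ (δ (φ (f i))) = algebraMap _ R (dualDerivation f j (f i))
    rw [h, dualDerivation_apply_self hf]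
    split_ifs <;> simp
  exact congr($hDE g)

theorem isCoord_pderiv : IsCoord (X : ι → MvPolynomial ι K) fun i => (pderiv i).toLinearMap where
  isDerivation i := isDerivation_derivation (pderiv i)
  apply i j := by simp [pderiv_X, Pi.single_apply, eq_comm]
  lie_mem_one i j := by simp [Ring.lie_def, mul_comm]
  adjoin_eq_top := MvPolynomial.adjoin_range_X

variable [Fintype ι] [CharZero K] {f : ι → MvPolynomial ι K} (hf : IsUnit (jacobianMatrix f).det)
  {g : MvPolynomial ι K}
include hf

theorem exists_C_eq_of_forall_dualDerivation_eq_zero (hg : ∀ j, dualDerivation f j g = 0) :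
    ∃ c, C c = g :=
  isCoord_pderiv.exists_algebraMap_eq fun l => by
    change pderiv l g = 0
    rw [pderiv_apply_eq_sum_mul_dualDerivation hf l]
    simp only [hg, mul_zero, Finset.sum_const_zero]

theorem mem_range_aeval_of_forall_mem_nilPart (hg : ∀ j, g ∈ nilPart (dualDerivation f j)) :
    g ∈ (aeval f : MvPolynomial ι K →ₐ[K] MvPolynomial ι K).range := by
  refine mem_of_forall_mem_nilPart_of_isDerivation (T := ⊤)
    (S := Subalgebra.toSubmodule (aeval f : MvPolynomial ι K →ₐ[K] MvPolynomial ι K).range)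
    (fun j => isDerivation_derivation (dualDerivation f j)) (fun i j _ => ?_)
    (fun i j => dualDerivation_apply_self hf j i) (fun _ _ _ => trivial) (fun _ _ _ => trivial)
    (fun i a ha => Subalgebra.mul_mem _ ⟨X i, aeval_X f i⟩ ha) (fun a _ ha => ?_) trivial hg
  · refine commute_iff_lie_eq.2 (LinearMap.ext fun a => ?_)
    simpa [Derivation.commutator_apply, Ring.lie_def] using congr($(lie_dualDerivation hf i j) a)
  · obtain ⟨c, rfl⟩ := exists_C_eq_of_forall_dualDerivation_eq_zero hf ha
    exact Subalgebra.algebraMap_mem _ c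

end PolynomialTaylor

section LeibnizDet

variable {S R : Type*} [CommRing S] [Ring R] [Algebra S R] {m : ℕ}

theorem list_prod_ofFn_update {M : Type*} [Monoid M] {m : ℕ} {g : Fin m → M}
    (hg : ∀ i b, Commute (g i) b) (j : Fin m) (a : M) :
    (List.ofFn (Function.update g j a)).prod = a * (List.ofFn (Function.update g j 1)).prod := by
  induction m with
  | zero => exact j.elim0
  | succ m ih =>
    rw [List.ofFn_succ, List.ofFn_succ, List.prod_cons, List.prod_cons]
    rcases Fin.eq_zero_or_eq_succ j with rfl | ⟨j, rfl⟩
    · simp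
    · have htail (c : M) : (fun i : Fin m => Function.update g j.succ c i.succ) =
          Function.update (fun i => g i.succ) j c :=
        Function.update_comp_eq_of_injective g (Fin.succ_injective m) j c
      rw [htail, htail, ih (fun i => hg i.succ), Function.update_of_ne (Fin.succ_ne_zero j).symm,
        Function.update_of_ne (Fin.succ_ne_zero j).symm, (hg 0 a).left_comm]

theorem list_prod_ofFn_algebraMap (g : Fin m → S) :
    (List.ofFn fun i => algebraMap S R (g i)).prod = algebraMap S R (∏ i, g i) := by
  rw [← List.prod_ofFn, map_list_prod, List.map_ofFn]
  rfl

theorem leibnizDet_eq_det (M : Matrix (Fin m) (Fin m) S) : leibnizDet M = M.det := by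
  rw [← Matrix.det_transpose, Matrix.det_apply, leibnizDet]
  simp only [List.prod_ofFn, Matrix.transpose_apply]
  rfl

theorem leibnizDet_map (M : Matrix (Fin m) (Fin m) S) :
    leibnizDet (M.map (algebraMap S R)) = algebraMap S R M.det := by
  simp only [← leibnizDet_eq_det, leibnizDet, map_sum, map_zsmul, List.prod_ofFn,
    ← list_prod_ofFn_algebraMap, Matrix.map_apply]

theorem leibnizDet_updateRow_eq_sum (M : Matrix (Fin m) (Fin m) S) (j : Fin m) (v : Fin m → R) :
    leibnizDet ((M.map (algebraMap S R)).updateRow j v) = ∑ π : Equiv.Perm (Fin m),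
      (Equiv.Perm.sign π : ℤ) • (∏ i, Function.update (fun i => M i (π i)) j 1 i) • v (π j) := by
  refine Finset.sum_congr rfl fun π _ => ?_
  have hrow : (fun i => ((M.map (algebraMap S R)).updateRow j v) i (π i)) =
      Function.update (fun i => algebraMap S R (M i (π i))) j (v (π j)) := by
    funext i
    rcases eq_or_ne i j with rfl | h <;> simp [*]
  have hone : Function.update (fun i => algebraMap S R (M i (π i))) j 1 =
      fun i => algebraMap S R (Function.update (fun i => M i (π i)) j 1 i) := by
    funext i
    rcases eq_or_ne i j with rfl | h <;> simp [*]
  rw [hrow, list_prod_ofFn_update fun i => Algebra.commutes _, hone, list_prod_ofFn_algebraMap,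
    ← Algebra.commutes, ← Algebra.smul_def]

theorem adjugate_apply_eq_sum (M : Matrix (Fin m) (Fin m) S) (l j : Fin m) :
    M.adjugate l j = ∑ π : Equiv.Perm (Fin m), (Equiv.Perm.sign π : ℤ) •
      (∏ i, Function.update (fun i => M i (π i)) j 1 i) • (Pi.single l 1 : Fin m → S) (π j) := by
  rw [← leibnizDet_updateRow_eq_sum, Matrix.adjugate_apply, leibnizDet_eq_det]
  rfl

theorem leibnizDet_updateRow (M : Matrix (Fin m) (Fin m) S) (j : Fin m) (v : Fin m → R) :
    leibnizDet ((M.map (algebraMap S R)).updateRow j v) = ∑ l, M.adjugate l j • v l := by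
  simp only [leibnizDet_updateRow_eq_sum, adjugate_apply_eq_sum, Finset.sum_smul, smul_assoc]
  rw [Finset.sum_comm]
  refine Finset.sum_congr rfl fun π _ => ?_
  simp [Pi.single_apply, ite_smul]

end LeibnizDet

section TensorGenerators

open Algebra.TensorProduct

attribute [local instance] Algebra.TensorProduct.rightAlgebra

theorem isDerivation_lTensor {K P W : Type*} [Field K] [CommRing P] [Algebra K P] [Ring W]
    [Algebra K W] (E : Derivation K P P) : IsDerivation (LinearMap.lTensor W E.toLinearMap) := by
  intro a b
  induction a using TensorProduct.induction_on with
  | zero => simp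
  | add a a' ha ha' => rw [add_mul, map_add, map_add, ha, ha']; noncomm_ring
  | tmul w f =>
    induction b using TensorProduct.induction_on with
    | zero => simp
    | add b b' hb hb' => rw [mul_add, map_add, map_add, hb, hb']; noncomm_ring
    | tmul v g =>
      simp [← TensorProduct.tmul_add, mul_comm, add_comm]

variable {K : Type*} [Field K] {n m : ℕ}

theorem isWeylFamily_mulLeft_X_pderiv :
    IsWeylFamily (Sum.elim (fun i => LinearMap.mulLeft K (MvPolynomial.X i))
      (fun i => (MvPolynomial.pderiv i).toLinearMap) :
        Fin n ⊕ Fin n → Module.End K (MvPolynomial (Fin n) K)) := by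
  have hcoord := isCoord_pderiv (K := K) (ι := Fin n)
  have hpq (i j : Fin n) : ⁅((MvPolynomial.pderiv i).toLinearMap : Module.End K _),
      LinearMap.mulLeft K (MvPolynomial.X j : MvPolynomial (Fin n) K)⁆ =
        if i = j then 1 else 0 := by
    rw [(hcoord.isDerivation i).lie_mulLeft, hcoord.apply]
    split_ifs
    exacts [LinearMap.mulLeft_one .., LinearMap.mulLeft_zero_eq_zero ..]
  have hpp (i j : Fin n) : ⁅((MvPolynomial.pderiv i).toLinearMap :
      Module.End K (MvPolynomial (Fin n) K)), (MvPolynomial.pderiv j).toLinearMap⁆ = 0 :=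
    commute_iff_lie_eq.1 (hcoord.commute i j)
  have hqq (i j : Fin n) : ⁅LinearMap.mulLeft K (MvPolynomial.X i : MvPolynomial (Fin n) K),
      LinearMap.mulLeft K (MvPolynomial.X j)⁆ = 0 :=
    commute_iff_lie_eq.1 (LinearMap.ext fun g => mul_left_comm (MvPolynomial.X i) _ g)
  exact .of_lie hpq hpp hqq

/-- The homomorphism out of the Weyl algebra that sends its generators to a Weyl family. -/
def weylLift {R : Type*} [Ring R] [Algebra K R] {u : Fin n ⊕ Fin n → R} (hu : IsWeylFamily u) :
    Weyl K n →ₐ[K] R :=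
  RingQuot.liftAlgHom K ⟨FreeAlgebra.lift K u, by
    rintro _ _ (⟨i, j⟩ | ⟨i, j⟩ | ⟨i, j⟩)
    · simpa [conjugate, Ring.lie_def, sub_eq_iff_eq_add', apply_ite] using
        hu (Sum.inl i) (Sum.inl j)
    · simpa [conjugate, Ring.lie_def, sub_eq_zero] using hu (Sum.inl i) (Sum.inr j)
    · simpa [conjugate, Ring.lie_def, neg_add_eq_zero] using hu (Sum.inr i) (Sum.inl j)⟩

instance nontrivial_weyl : Nontrivial (Weyl K n) :=
  (weylLift (isWeylFamily_mulLeft_X_pderiv (K := K) (n := n))).toRingHom.domain_nontrivial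

/-- The generators `q_i` and `p_i` of the Weyl algebra. -/
def weylGen (K : Type*) [Field K] (n : ℕ) (b : Fin n ⊕ Fin n) : Weyl K n :=
  RingQuot.mkAlgHom K (WeylRel K n) (FreeAlgebra.ι K b)

theorem isWeylFamily_weylGen : IsWeylFamily (weylGen K n) := by
  have hpq (i j : Fin n) : ⁅weylGen K n (Sum.inr i), weylGen K n (Sum.inl j)⁆ =
      if i = j then 1 else 0 := by
    rw [Ring.lie_def, sub_eq_iff_eq_add']
    simpa only [weylGen, map_mul, map_add, apply_ite (RingQuot.mkAlgHom K (WeylRel K n)),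
      map_one, map_zero] using RingQuot.mkAlgHom_rel K (WeylRel.pq (K := K) i j)
  have hpp (i j : Fin n) : ⁅weylGen K n (Sum.inr i), weylGen K n (Sum.inr j)⁆ = 0 := by
    rw [Ring.lie_def, sub_eq_zero]
    simpa only [weylGen, map_mul] using RingQuot.mkAlgHom_rel K (WeylRel.pp (K := K) i j)
  have hqq (i j : Fin n) : ⁅weylGen K n (Sum.inl i), weylGen K n (Sum.inl j)⁆ = 0 := by
    rw [Ring.lie_def, sub_eq_zero]
    simpa only [weylGen, map_mul] using RingQuot.mkAlgHom_rel K (WeylRel.qq (K := K) i j)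
  exact .of_lie hpq hpp hqq

theorem isWeylFamily_gen : IsWeylFamily (gen ∘ Sum.inl : Fin n ⊕ Fin n → Alg K n m) :=
  isWeylFamily_weylGen.map (K := K) (R := Weyl K n) (S := Alg K n m) includeLeft

theorem adjoin_range_weylGen : Algebra.adjoin K (Set.range (weylGen K n)) = ⊤ := by
  have hrange : Set.range (weylGen K n) =
      RingQuot.mkAlgHom K (WeylRel K n) '' Set.range (FreeAlgebra.ι K) := by
    rw [← Set.range_comp]; rfl
  rw [hrange, ← AlgHom.map_adjoin, FreeAlgebra.adjoin_range_ι, Algebra.map_top,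
    AlgHom.range_eq_top]
  exact RingQuot.mkAlgHom_surjective K _

theorem algebraMap_mem_polyPart (g : MvPolynomial (Fin m) K) :
    algebraMap _ (Alg K n m) g ∈ polyPart K n m :=
  ⟨g, rfl⟩

theorem adjoin_range_gen : Algebra.adjoin K (Set.range (gen : Gen n m → Alg K n m)) = ⊤ := by
  have hl : Algebra.adjoin K (Set.range (gen ∘ Sum.inl : Fin n ⊕ Fin n → Alg K n m)) =
      (includeLeft : Weyl K n →ₐ[K] Alg K n m).range := by
    change Algebra.adjoin K (Set.range ((includeLeft : _ →ₐ[K] Alg K n m) ∘ weylGen K n)) = _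
    rw [Set.range_comp, ← AlgHom.map_adjoin, adjoin_range_weylGen, Algebra.map_top]
  have hr : Algebra.adjoin K (Set.range (gen ∘ Sum.inr : Fin m → Alg K n m)) =
      polyPart K n m := by
    change Algebra.adjoin K (Set.range ((includeRight : _ →ₐ[K] Alg K n m) ∘ MvPolynomial.X)) = _
    rw [Set.range_comp, ← AlgHom.map_adjoin, MvPolynomial.adjoin_range_X, Algebra.map_top]
    rfl
  have hgen : (gen : Gen n m → Alg K n m) = Sum.elim (gen ∘ Sum.inl) (gen ∘ Sum.inr) :=
    (Sum.elim_comp_inl_inr gen).symm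
  rw [hgen, Set.Sum.elim_range, Algebra.adjoin_union, hl, hr]
  simpa [polyPart] using
    (map_range (AlgHom.id K (Weyl K n)) (AlgHom.id K (MvPolynomial (Fin m) K))).symm

theorem commute_gen_inr (k : Fin m) (a : Alg K n m) : Commute a (gen (Sum.inr k)) :=
  (Algebra.commutes (MvPolynomial.X k : MvPolynomial (Fin m) K) a).symm

theorem isCoord_gen : IsCoord (gen : Gen n m → Alg K n m)
    (Sum.elim (weylPartial K (gen ∘ Sum.inl)) centralPartial) where
  isDerivation := Sum.forall.2 ⟨isDerivation_weylPartial _, fun l => isDerivation_lTensor _⟩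
  apply := by
    rintro (b | l) (c | k)
    · simpa using isWeylFamily_gen.weylPartial_apply (K := K) (R := Alg K n m) b c
    · exact forall_weylPartial_eq_zero_iff.2 (fun b => commute_gen_inr k _) b
    · simp [centralPartial, gen]
    · by_cases h : l = k
      · subst h; simp [centralPartial, gen, one_def]
      · simp [centralPartial, gen, h]
  lie_mem_one := by
    rintro (b | l) (c | k)
    · exact isWeylFamily_gen.lie_mem_one (K := K) (R := Alg K n m) b c
    · rw [commute_iff_lie_eq.1 (commute_gen_inr k _)]; exact zero_mem _
    all_goals rw [commute_iff_lie_eq.1 (commute_gen_inr l _).symm]; exact zero_mem _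
  adjoin_eq_top := adjoin_range_gen

end TensorGenerators

section Endomorphism

open Algebra.TensorProduct MvPolynomial

attribute [local instance] Algebra.TensorProduct.rightAlgebra

variable {K : Type*} [Field K] {n m : ℕ}

theorem partial'_inl (σ : Alg K n m →ₐ[K] Alg K n m) (Δ : K) (b : Fin n ⊕ Fin n) :
    partial' σ Δ (Sum.inl b) = weylPartial K (σ ∘ gen ∘ Sum.inl) b := by
  rcases b with b | b
  · rfl
  · exact funext fun a => (weylPartial_inr_apply (K := K) (σ ∘ gen ∘ Sum.inl) b a).symm

theorem isWeylFamily_map_gen (σ : Alg K n m →ₐ[K] Alg K n m) :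
    IsWeylFamily (σ ∘ gen ∘ Sum.inl) :=
  isWeylFamily_gen.map (K := K) (R := Alg K n m) (S := Alg K n m) σ

theorem range_le_of_forall_gen_mem {S : Type*} [Ring S] [Algebra K S] {φ : Alg K n m →ₐ[K] S}
    {B : Subalgebra K S} (h : ∀ g, φ (gen g) ∈ B) : φ.range ≤ B := by
  rw [← Algebra.map_top, ← adjoin_range_gen, AlgHom.map_adjoin, Algebra.adjoin_le_iff]
  rintro _ ⟨_, ⟨g, rfl⟩, rfl⟩
  exact h g

theorem algebraMap_injective :
    Function.Injective (algebraMap (MvPolynomial (Fin m) K) (Alg K n m)) :=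
  includeRight_injective (FaithfulSMul.algebraMap_injective K (Weyl K n))

theorem range_le_imagePoly (σ : Alg K n m →ₐ[K] Alg K n m) : σ.range ≤ imagePoly σ :=
  le_sup_left

theorem polyPart_le_imagePoly (σ : Alg K n m →ₐ[K] Alg K n m) : polyPart K n m ≤ imagePoly σ :=
  le_sup_right

theorem mem_nilPart_weylPartial_of_mem_imagePoly {σ : Alg K n m →ₐ[K] Alg K n m} {a : Alg K n m}
    (ha : a ∈ imagePoly σ) (b : Fin n ⊕ Fin n) :
    a ∈ nilPart (weylPartial K (σ ∘ gen ∘ Sum.inl) b) := by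
  suffices h : imagePoly σ ≤ (isDerivation_weylPartial (K := K) (σ ∘ gen ∘ Sum.inl) b).nilSubalgebra
    from h ha
  have hσ (a : Alg K n m) :
      σ (weylPartial K (gen ∘ Sum.inl) b a) = weylPartial K (σ ∘ gen ∘ Sum.inl) b (σ a) := by
    rcases b with b | b <;> simp [weylPartial_eq_lie, conjugate, Ring.lie_def]
  refine sup_le ?_ ?_
  · rintro _ ⟨a, rfl⟩
    exact mapsTo_nilPart (map_zero σ) hσ (isCoord_gen.mem_nilPart (Sum.inl b) a)
  · rintro _ ⟨g, rfl⟩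
    exact ⟨1, forall_weylPartial_eq_zero_iff.2
      (fun b => Algebra.commute_algebraMap_right g (σ (gen (Sum.inl b)) : Alg K n m)) b⟩

section CharZero

variable [CharZero K]

theorem mem_polyPart_of_forall_commute (σ : Alg K n m →ₐ[K] Alg K n m) {c : Alg K n m}
    (hc : ∀ b, Commute (σ (gen (Sum.inl b))) c) : c ∈ polyPart K n m :=
  isCoord_gen.mem_of_forall_commute (isWeylFamily_map_gen σ)
    (fun _ l => commute_gen_inr l _) (fun _ => algebraMap_mem_polyPart _) hc

theorem exists_map_gen_inr_eq (σ : Alg K n m →ₐ[K] Alg K n m) :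
    ∃ f : Fin m → MvPolynomial (Fin m) K,
      ∀ k, σ (gen (Sum.inr k)) = algebraMap _ (Alg K n m) (f k) := by
  choose f hf using fun k =>
    mem_polyPart_of_forall_commute σ fun b =>
      (commute_gen_inr (K := K) (n := n) k (gen (Sum.inl b))).map σ
  exact ⟨f, fun k => (hf k).symm⟩

theorem mem_imagePoly_iff_forall_mem_nilPart {σ : Alg K n m →ₐ[K] Alg K n m} {a : Alg K n m} :
    a ∈ imagePoly σ ↔ ∀ b, a ∈ nilPart (weylPartial K (σ ∘ gen ∘ Sum.inl) b) := by
  refine ⟨mem_nilPart_weylPartial_of_mem_imagePoly, fun h => ?_⟩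
  exact (isWeylFamily_map_gen σ).mem_of_forall_mem_nilPart (K := K) (R := Alg K n m) (T := ⊤)
    (fun _ => trivial) (fun b => range_le_imagePoly σ (σ.mem_range_self _))
    (fun c _ hc => polyPart_le_imagePoly σ (mem_polyPart_of_forall_commute σ hc)) trivial h

end CharZero

variable {σ : Alg K n m →ₐ[K] Alg K n m} {f : Fin m → MvPolynomial (Fin m) K}
  (hf : ∀ k, σ (gen (Sum.inr k)) = algebraMap _ (Alg K n m) (f k))

section
include hf

theorem map_algebraMap_eq_algebraMap_aeval (g : MvPolynomial (Fin m) K) :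
    σ (algebraMap _ (Alg K n m) g) = algebraMap _ (Alg K n m) (aeval f g) := by
  have h : σ.comp includeRight = includeRight.comp (aeval f) :=
    MvPolynomial.algHom_ext fun k => by
      rw [AlgHom.comp_apply, AlgHom.comp_apply, aeval_X]
      exact hf k
  exact congr($h g)

theorem jac_eq_map : jac σ = (jacobianMatrix f).map (algebraMap _ (Alg K n m)) := by
  ext i l
  rw [jac, Matrix.of_apply, hf]
  rfl

theorem det_jacobianMatrix {Δ : K} (hσ : leibnizDet (jac σ) = algebraMap K (Alg K n m) Δ) :
    (jacobianMatrix f).det = C Δ := by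
  apply algebraMap_injective (n := n)
  rw [jac_eq_map hf, leibnizDet_map (S := MvPolynomial (Fin m) K) (R := Alg K n m)] at hσ
  exact hσ.trans ((includeRight : _ →ₐ[K] Alg K n m).commutes Δ).symm

theorem partial'_inr {Δ : K} (hΔ : Δ ≠ 0)
    (hσ : leibnizDet (jac σ) = algebraMap K (Alg K n m) Δ) (j : Fin m) (a : Alg K n m) :
    partial' σ Δ (Sum.inr j) a =
      LinearMap.lTensor (Weyl K n) (dualDerivation f j).toLinearMap a := by
  have hinv : (jacobianMatrix f)⁻¹ = Δ⁻¹ • (jacobianMatrix f).adjugate := by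
    refine Matrix.inv_eq_right_inv ?_
    rw [Matrix.mul_smul, Matrix.mul_adjugate, det_jacobianMatrix hf hσ, ← algebraMap_eq,
      algebraMap_smul, inv_smul_smul₀ hΔ]
  have hdet : leibnizDet ((jac σ).updateRow j fun l => centralPartial l a) =
      ∑ l, ((1 : Weyl K n) ⊗ₜ[K] (jacobianMatrix f).adjugate l j) * centralPartial l a := by
    rw [jac_eq_map hf, leibnizDet_updateRow (S := MvPolynomial (Fin m) K) (R := Alg K n m)]
    exact Finset.sum_congr rfl fun l _ => Algebra.smul_def _ _
  rw [partial', hdet]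
  clear hdet
  induction a using TensorProduct.induction_on with
  | zero => simp
  | add a b ha hb => simp only [map_add, mul_add, smul_add, Finset.sum_add_distrib, ha, hb]
  | tmul w g =>
    simp [centralPartial, dualDerivation_apply, hinv, TensorProduct.tmul_sum, Finset.smul_sum,
      mul_comm]

end

theorem exists_partial'_inr_eq_lTensor [CharZero K] {Δ : K} (hΔ : Δ ≠ 0)
    (hσ : leibnizDet (jac σ) = algebraMap K (Alg K n m) Δ) :
    ∃ f : Fin m → MvPolynomial (Fin m) K,
      (∀ k, σ (gen (Sum.inr k)) = algebraMap _ (Alg K n m) (f k)) ∧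
      IsUnit (jacobianMatrix f).det ∧
      ∀ j, partial' σ Δ (Sum.inr j) =
        LinearMap.lTensor (Weyl K n) (dualDerivation f j).toLinearMap := by
  obtain ⟨f, hf⟩ := exists_map_gen_inr_eq σ
  refine ⟨f, hf, ?_, fun j => funext (partial'_inr hf hΔ hσ j)⟩
  exact det_jacobianMatrix hf hσ ▸ (IsUnit.mk0 Δ hΔ).map C

-- Instance search does not unify the semiring underlying `Subalgebra K (Alg K n m)` with a ring.
instance instRingSubalgebra (D : Subalgebra K (Alg K n m)) : Ring D :=
  Subalgebra.toRing (R := K) (A := Alg K n m) D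

/-- The `K`-linear maps `δ j` are derivations of `S` that induce on the polynomials, along
`ψ : S →ₐ[K] A_n ⊗ P_m`, the partial derivatives with respect to `f`. -/
structure ExtendsDual {S : Type*} [Ring S] [Algebra K S] (ψ : S →ₐ[K] Alg K n m)
    (f : Fin m → MvPolynomial (Fin m) K) (δ : Fin m → Module.End K S) : Prop where
  isDerivation : ∀ j, IsDerivation (δ j)
  apply : ∀ j a g, ψ a = algebraMap _ _ g → ψ (δ j a) = algebraMap _ _ (dualDerivation f j g)

theorem extendsDual_lTensor (f : Fin m → MvPolynomial (Fin m) K) :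
    ExtendsDual (S := Alg K n m) (AlgHom.id K (Alg K n m)) f fun j =>
      LinearMap.lTensor (Weyl K n) (dualDerivation f j).toLinearMap where
  isDerivation _ := isDerivation_lTensor _
  apply := by
    rintro j _ g rfl
    exact LinearMap.lTensor_tmul ..

theorem IsCentralPartials.extendsDual (hf : ∀ k, σ (gen (Sum.inr k)) = algebraMap _ _ (f k))
    (hdet : IsUnit (jacobianMatrix f).det)
    {D : Subalgebra K (Alg K n m)} (hD : imagePoly σ ≤ D) {δ : Fin m → Module.End K D}
    (hδ : IsCentralPartials σ D δ) : ExtendsDual (S := D) D.val f δ where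
  isDerivation := hδ.1
  apply j a g hag := by
    have hP : polyPart K n m ≤ D := (polyPart_le_imagePoly σ).trans hD
    have hσD : σ.range ≤ D := (range_le_imagePoly σ).trans hD
    let φ : MvPolynomial (Fin m) K →ₐ[K] D :=
      (includeRight : _ →ₐ[K] Alg K n m).codRestrict D fun g => hP ⟨g, rfl⟩
    obtain rfl : a = φ g := Subtype.ext hag
    refine IsDerivation.apply_eq_algebraMap_dualDerivation (R := Alg K n m) (S := D) hdet (hδ.1 j)
      (φ := φ) (ψ := D.val) (fun _ => rfl) (fun i => ?_) g
    have hi : φ (f i) = ⟨σ (gen (Sum.inr i)), hσD (σ.mem_range_self _)⟩ :=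
      Subtype.ext (hf i).symm
    rw [hi, hδ.2]
    simp only [Sum.inr.injEq, eq_comm (a := i)]
    split_ifs <;> simp

namespace ExtendsDual

variable {S : Type*} [Ring S] [Algebra K S] {ψ : S →ₐ[K] Alg K n m} {δ : Fin m → Module.End K S}

theorem iterate_apply (hδ : ExtendsDual ψ f δ) (j : Fin m) {x : S} {g : MvPolynomial (Fin m) K}
    (hx : ψ x = algebraMap _ _ g) (k : ℕ) :
    ψ ((δ j)^[k] x) = algebraMap _ _ ((dualDerivation f j)^[k] g) := by
  induction k with
  | zero => exact hx
  | succ k ih => rw [Function.iterate_succ_apply', Function.iterate_succ_apply', hδ.apply j _ _ ih]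

theorem mem_nilPart_dualDerivation (hδ : ExtendsDual ψ f δ) {j : Fin m} {x : S}
    {g : MvPolynomial (Fin m) K} (hx : ψ x = algebraMap _ _ g) (hnil : x ∈ nilPart (δ j)) :
    g ∈ nilPart (dualDerivation f j) := by
  obtain ⟨k, hk⟩ := hnil
  refine ⟨k, algebraMap_injective (n := n) ?_⟩
  rw [← hδ.iterate_apply j hx, hk, map_zero, map_zero]

theorem mem_nilPart_of_apply_mem_range (hδ : ExtendsDual ψ f δ)
    (hf : ∀ k, σ (gen (Sum.inr k)) = algebraMap _ _ (f k))
    (hdet : IsUnit (jacobianMatrix f).det) (hψ : Function.Injective ψ)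
    (hσψ : imagePoly σ ≤ ψ.range)
    (hnil : ∀ j b y, ψ y = σ (gen (Sum.inl b)) → y ∈ nilPart (δ j)) {x : S}
    (hx : ψ x ∈ σ.range) (j : Fin m) : x ∈ nilPart (δ j) := by
  suffices h : σ.range ≤ (hδ.isDerivation j).nilSubalgebra.map ψ by
    obtain ⟨y, hy, hyx⟩ := h hx
    exact hψ hyx ▸ hy
  refine range_le_of_forall_gen_mem (S := Alg K n m) (φ := σ) fun g => ?_
  obtain ⟨y, hy⟩ : σ (gen g) ∈ ψ.range := hσψ (range_le_imagePoly σ (σ.mem_range_self _))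
  refine ⟨y, ?_, hy⟩
  rcases g with b | k
  · exact hnil j b y hy
  · refine ⟨2, hψ ?_⟩
    rw [hδ.iterate_apply j (hy.trans (hf k)), Function.iterate_succ_apply, Function.iterate_one,
      dualDerivation_apply_self hdet, map_zero]
    split_ifs <;> simp

variable [CharZero K]

theorem forall_weylPartial_eq_zero_and_forall_eq_zero_iff (hδ : ExtendsDual ψ f δ)
    (hdet : IsUnit (jacobianMatrix f).det) (hψ : Function.Injective ψ) {x : S} :
    ((∀ b, weylPartial K (σ ∘ gen ∘ Sum.inl) b (ψ x) = 0) ∧ ∀ j, δ j x = 0) ↔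
      ψ x ∈ Set.range (algebraMap K (Alg K n m)) := by
  constructor
  · rintro ⟨hσx, hδx⟩
    obtain ⟨g, hg⟩ :=
      mem_polyPart_of_forall_commute σ (forall_weylPartial_eq_zero_iff.1 hσx)
    replace hg : algebraMap _ (Alg K n m) g = ψ x := hg
    have hg0 (j : Fin m) : dualDerivation f j g = 0 :=
      algebraMap_injective (n := n) (by rw [← hδ.apply j x g hg.symm, hδx, map_zero, map_zero])
    obtain ⟨c, rfl⟩ := exists_C_eq_of_forall_dualDerivation_eq_zero hdet hg0
    exact ⟨c, hg ▸ ((includeRight : _ →ₐ[K] Alg K n m).commutes c).symm⟩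
  · rintro ⟨c, hc⟩
    obtain rfl : algebraMap K S c = x := hψ (by rw [ψ.commutes, hc])
    refine ⟨fun b => ?_, fun j => (hδ.isDerivation j).map_algebraMap c⟩
    rw [ψ.commutes, (isDerivation_weylPartial _ _).map_algebraMap]

theorem forall_mem_nilPart_iff (hδ : ExtendsDual ψ f δ)
    (hf : ∀ k, σ (gen (Sum.inr k)) = algebraMap _ _ (f k))
    (hdet : IsUnit (jacobianMatrix f).det) (hψ : Function.Injective ψ)
    (hσψ : imagePoly σ ≤ ψ.range)
    (hnil : ∀ j b y, ψ y = σ (gen (Sum.inl b)) → y ∈ nilPart (δ j)) {x : S} :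
    ((∀ b, ψ x ∈ nilPart (weylPartial K (σ ∘ gen ∘ Sum.inl) b)) ∧ ∀ j, x ∈ nilPart (δ j)) ↔
      ψ x ∈ σ.range := by
  refine ⟨fun ⟨hσx, hδx⟩ => ?_, fun h =>
    ⟨mem_nilPart_weylPartial_of_mem_imagePoly (range_le_imagePoly σ h),
      hδ.mem_nilPart_of_apply_mem_range hf hdet hψ hσψ hnil h⟩⟩
  let N : Subalgebra K S := ⨅ j, (hδ.isDerivation j).nilSubalgebra
  have hN {y : S} : y ∈ N ↔ ∀ j, y ∈ nilPart (δ j) := Algebra.mem_iInf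
  refine (isWeylFamily_map_gen σ).mem_of_forall_mem_nilPart (K := K) (R := Alg K n m)
    (T := N.map ψ) (fun b => ?_) (fun b => σ.mem_range_self _) ?_ ⟨x, hN.2 hδx, rfl⟩ hσx
  · obtain ⟨y, hy⟩ := hσψ (range_le_imagePoly σ (σ.mem_range_self (gen (Sum.inl b))))
    exact ⟨y, hN.2 fun j => hnil j b y hy, hy⟩
  · rintro _ ⟨y, hy, rfl⟩ hc
    obtain ⟨g, hg⟩ := mem_polyPart_of_forall_commute σ hc
    replace hg : algebraMap _ (Alg K n m) g = ψ y := hg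
    obtain ⟨p, rfl⟩ := mem_range_aeval_of_forall_mem_nilPart hdet fun j =>
      hδ.mem_nilPart_dualDerivation hg.symm (hN.1 hy j)
    exact ⟨algebraMap _ _ p, (map_algebraMap_eq_algebraMap_aeval hf p).trans hg⟩

end ExtendsDual

end Endomorphism

section CentralExtension

open Algebra.TensorProduct MvPolynomial

attribute [local instance] Algebra.TensorProduct.rightAlgebra

variable {K : Type*} [Field K] {n m : ℕ}

/-- The endomorphism of `A_n ⊗ P_m` that agrees with `σ` on `A_n` and fixes `P_m`; the elements of
`P_m` are central, so they commute with the image of `σ`. -/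
def fixCentral (σ : Alg K n m →ₐ[K] Alg K n m) : Alg K n m →ₐ[K] Alg K n m :=
  Algebra.TensorProduct.lift (σ.comp includeLeft) includeRight fun w g =>
    (Algebra.commute_algebraMap_right g (σ (w ⊗ₜ 1)) : Commute (σ (w ⊗ₜ 1) : Alg K n m) _)

variable (σ : Alg K n m →ₐ[K] Alg K n m)

theorem fixCentral_gen_inl (b : Fin n ⊕ Fin n) :
    fixCentral σ (gen (Sum.inl b)) = σ (gen (Sum.inl b)) := by
  refine (lift_tmul ..).trans ?_
  rw [map_one, mul_one]
  rfl

theorem fixCentral_algebraMap (g : MvPolynomial (Fin m) K) :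
    fixCentral σ (algebraMap _ (Alg K n m) g) = algebraMap _ (Alg K n m) g := by
  refine (lift_tmul ..).trans ?_
  rw [map_one, one_mul]
  rfl

variable [CharZero K]

theorem range_fixCentral : (fixCentral σ).range = imagePoly σ := by
  have hP (g : MvPolynomial (Fin m) K) : algebraMap _ (Alg K n m) g ∈ (fixCentral σ).range :=
    ⟨_, fixCentral_algebraMap σ g⟩
  apply le_antisymm
  · refine range_le_of_forall_gen_mem (S := Alg K n m) (Sum.forall.2 ⟨fun b => ?_, fun k => ?_⟩)
    · exact range_le_imagePoly σ ⟨_, (fixCentral_gen_inl σ b).symm⟩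
    · exact polyPart_le_imagePoly σ ⟨X k, (fixCentral_algebraMap σ (X k)).symm⟩
  · refine sup_le ?_ ?_
    · obtain ⟨f, hf⟩ := exists_map_gen_inr_eq σ
      refine range_le_of_forall_gen_mem (S := Alg K n m) (Sum.forall.2 ⟨fun b => ?_, fun k => ?_⟩)
      · exact ⟨_, fixCentral_gen_inl σ b⟩
      · exact hf k ▸ hP (f k)
    · rintro _ ⟨g, rfl⟩
      exact hP g

theorem fixCentral_injective : Function.Injective (fixCentral σ) := by
  refine isWeylFamily_gen.injective_of_forall_commute (K := K) (R := Alg K n m) (S := Alg K n m)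
    (fun b a => isCoord_gen.mem_nilPart (Sum.inl b) a) (fixCentral σ) fun a ha ha0 => ?_
  obtain ⟨g, rfl⟩ := mem_polyPart_of_forall_commute (AlgHom.id K (Alg K n m)) ha
  exact (fixCentral_algebraMap σ g).symm.trans ha0

theorem exists_isCentralPartials {f : Fin m → MvPolynomial (Fin m) K}
    (hf : ∀ k, σ (gen (Sum.inr k)) = algebraMap _ _ (f k))
    (hdet : IsUnit (jacobianMatrix f).det) :
    ∃ δ : Fin m → imagePoly σ →ₗ[K] imagePoly σ, IsCentralPartials σ (imagePoly σ) δ := by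
  let e : Alg K n m ≃ₐ[K] imagePoly σ :=
    (AlgEquiv.ofInjective (fixCentral σ) (fixCentral_injective σ)).trans
      (Subalgebra.equivOfEq _ _ (range_fixCentral σ))
  refine ⟨fun j => e.toLinearEquiv.conj (LinearMap.lTensor _ (dualDerivation f j).toLinearMap),
    fun j => (isDerivation_lTensor _).conj (R := Alg K n m) (S := imagePoly σ) e, fun j g hg => ?_⟩
  rcases g with b | k
  · have hb : (⟨σ (gen (Sum.inl b)), hg⟩ : imagePoly σ) = e (gen (Sum.inl b)) :=
      Subtype.ext (fixCentral_gen_inl σ b).symm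
    rw [hb]
    simp [LinearEquiv.conj_apply, gen]
  · have hk : (⟨σ (gen (Sum.inr k)), hg⟩ : imagePoly σ) = e (1 ⊗ₜ f k) :=
      Subtype.ext ((hf k).trans (fixCentral_algebraMap σ (f k)).symm)
    rw [hk]
    simp [LinearEquiv.conj_apply, dualDerivation_apply_self hdet, eq_comm (a := j)]
    split_ifs <;> simp [← Algebra.TensorProduct.one_def]

end CentralExtension

theorem IsCentralPartials.mem_nilPart_of_coe_eq {K : Type*} [Field K] {n m : ℕ}
    {σ : Alg K n m →ₐ[K] Alg K n m} {D : Subalgebra K (Alg K n m)} {δ : Fin m → Module.End K D}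
    (hδ : IsCentralPartials σ D δ) {b : Fin n ⊕ Fin n} {y : D} (hy : y = σ (gen (Sum.inl b)))
    (j : Fin m) : y ∈ nilPart (δ j) := by
  have hmem : σ (gen (Sum.inl b)) ∈ D := hy ▸ y.2
  obtain rfl : y = ⟨σ (gen (Sum.inl b)), hmem⟩ := Subtype.ext hy
  exact ⟨1, hδ.2 j _ _⟩

theorem and_exists_mem_iff_of_subset {S α : Type*} [SetLike S α] {D : S} {X : Set α}
    {P : α → Prop} {Q : ∀ a, a ∈ D → Prop} (hX : X ⊆ D) (h : ∀ a ha, P a ∧ Q a ha ↔ a ∈ X) (a : α) :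
    (P a ∧ ∃ ha : a ∈ D, Q a ha) ↔ a ∈ X :=
  ⟨fun ⟨hP, ha, hQ⟩ => (h a ha).1 ⟨hP, hQ⟩, fun ha =>
    have ⟨hP, hQ⟩ := (h a (hX ha)).2 ha
    ⟨hP, hX ha, hQ⟩⟩

end WeylPoly

end

theorem proposition5p9 {K : Type*} [Field K] [CharZero K] (n m : ℕ)
    (σ : WeylPoly.Alg K n m →ₐ[K] WeylPoly.Alg K n m)
    (Δ : K) (hΔ : Δ ≠ 0)
    (hσ : WeylPoly.leibnizDet (WeylPoly.jac σ) = algebraMap K (WeylPoly.Alg K n m) Δ) :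
    -- the operators `∂'_1, …, ∂'_s` on `A`
    (⋂ g, {a | WeylPoly.partial' σ Δ g a = 0}) =
        Set.range (algebraMap K (WeylPoly.Alg K n m)) ∧
    ((⋂ g, WeylPoly.nilPart (WeylPoly.partial' σ Δ g)) = (σ.range : Set (WeylPoly.Alg K n m)) ↔
      ∀ (j : Fin m) (b : Fin n ⊕ Fin n), σ (WeylPoly.gen (Sum.inl b)) ∈
        WeylPoly.nilPart (WeylPoly.partial' σ Δ (Sum.inr j))) ∧
    -- the partial derivatives with respect to `σ(x_1), …, σ(x_s)`
    (⋂ b, WeylPoly.nilPart (WeylPoly.partial' σ Δ (Sum.inl b))) =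
        (WeylPoly.imagePoly σ : Set (WeylPoly.Alg K n m)) ∧
    (∃ δ : Fin m → WeylPoly.imagePoly σ →ₗ[K] WeylPoly.imagePoly σ,
        WeylPoly.IsCentralPartials σ (WeylPoly.imagePoly σ) δ) ∧
    ∀ D : Subalgebra K (WeylPoly.Alg K n m), WeylPoly.imagePoly σ ≤ D →
      ∀ δ : Fin m → D →ₗ[K] D, WeylPoly.IsCentralPartials σ D δ →
        (∀ j, ∀ f : D, (f : WeylPoly.Alg K n m) ∈ WeylPoly.polyPart K n m →
          (δ j f : WeylPoly.Alg K n m) = WeylPoly.partial' σ Δ (Sum.inr j) f) ∧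
        {a | (∀ b, a ∈ WeylPoly.nilPart (WeylPoly.partial' σ Δ (Sum.inl b))) ∧
            ∃ h : a ∈ D, ∀ j, ⟨a, h⟩ ∈ WeylPoly.nilPart (δ j)} =
          (σ.range : Set (WeylPoly.Alg K n m)) ∧
        {a | (∀ b, WeylPoly.partial' σ Δ (Sum.inl b) a = 0) ∧
            ∃ h : a ∈ D, ∀ j, δ j ⟨a, h⟩ = 0} =
          Set.range (algebraMap K (WeylPoly.Alg K n m)) := by
  obtain ⟨f, hf, hdet, hinr⟩ := WeylPoly.exists_partial'_inr_eq_lTensor hΔ hσ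
  have hA := WeylPoly.extendsDual_lTensor (n := n) f
  simp only [Set.ext_iff, Set.mem_iInter, Sum.forall (α := Fin n ⊕ Fin n), Set.mem_ofPred_eq,
    WeylPoly.partial'_inl, hinr]
  refine ⟨fun a => ?_, ⟨fun h j b => ?_, fun h a => ?_⟩, fun a => ?_,
    WeylPoly.exists_isCentralPartials σ hf hdet, fun D hD δ hδ => ?_⟩
  · exact hA.forall_weylPartial_eq_zero_and_forall_eq_zero_iff hdet Function.injective_id
  · exact ((h _).2 (σ.mem_range_self _)).2 j
  · exact hA.forall_mem_nilPart_iff hf hdet Function.injective_id (fun a _ => ⟨a, rfl⟩)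
      (fun j b y (hy : y = _) => hy ▸ h j b)
  · exact WeylPoly.mem_imagePoly_iff_forall_mem_nilPart.symm
  · have hδD := hδ.extendsDual hf hdet hD
    refine ⟨?_, WeylPoly.and_exists_mem_iff_of_subset
        ((WeylPoly.range_le_imagePoly σ).trans hD) fun a ha => ?_,
      WeylPoly.and_exists_mem_iff_of_subset (Set.range_subset_iff.2 D.algebraMap_mem)
        fun a ha => ?_⟩
    · rintro j a ⟨g, hg⟩
      exact (hδD.apply j a g hg.symm).trans (hA.apply j a g hg.symm).symm
    · exact hδD.forall_mem_nilPart_iff (x := ⟨a, ha⟩) hf hdet Subtype.val_injective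
        (fun a ha => ⟨⟨a, hD ha⟩, rfl⟩) fun j b y hy => hδ.mem_nilPart_of_coe_eq hy j
    · exact hδD.forall_weylPartial_eq_zero_and_forall_eq_zero_iff hdet Subtype.val_injective
        (x := ⟨a, ha⟩)
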